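/- Let $\Omega\subset\mathbb R^2\cong\mathbb C$ be the open unit disk and let $\sigma\in L^\infty(\Omega)$ satisfy $\sigma\ge c>0$ a.e. for some constant $c$, be rotationally symmetric ($\sigma(z)=\sigma(|z|)$ for a.e. $z$) and satisfy $\sigma\equiv 1$ close to $\partial\Omega$. Let $L^2_\diamond(\partial\Omega)$ be the space of mean free functions in $L^2(\partial\Omega)$. For $\kappa\in\{\sigma,1\}$ let $\mathcal R_\kappa:L^2_\diamond(\partial\Omega)\to L^2_\diamond(\partial\Omega)$, $\mathcal R_\kappa\psi=u|_{\partial\Omega}$, be the Neumann-to-Dirichlet (ND) map, where $u\in H^1(\Omega)$ is the weak solution of $$\nabla\cdot\kappa\nabla u=0\ \text{ in }\Omega,\qquad \kappa\,\partial_\nu u=\psi\ \text{ on }\partial\Omega,\qquad \int_{\partial\Omega}u\,ds=0,$$ and put $\mathcal R_{\sigma,1}=\mathcal R_\sigma-\mathcal R_1$. Let $E_1,\dots,E_M\subset\partial\Omega$ (the electrodes) be open, connected, mutually disjoint and of equal length $|E_m|=|E|>0$, and let $\widetilde E_1,\dots,\widetilde E_M\subset\partial\Omega$ (the extended electrodes)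 be open, connected and mutually disjoint with $E_m\subset\overline{\widetilde E_m}$ for all $m$ and $\bigcup_m\overline{\widetilde E_m}=\partial\Omega$. With $\chi_m$ the characteristic function of $E_m$, set $$Q\varphi=\sum_{m=1}^M\frac{\chi_m}{|E_m|}\int_{\widetilde E_m}\varphi\,ds .$$ Let $N$ be even with $N<M$, let $\mathcal N=\{-N/2,\dots,-1,1,\dots,N/2\}$, and for $n\in\mathcal N$ let $\varphi_n(\theta)=\pi^{-1/2}\sin(n\theta)$ if $n<0$ and $\varphi_n(\theta)=\pi^{-1/2}\cos(n\theta)$ if $n>0$. Put $\psi_n=Q\varphi_n$ and $g_n=\mathcal R_{\sigma,1}\psi_n$, with coefficient vectors $(\hat\psi_n)_j=(\psi_n,\varphi_j)_{L^2(\partial\Omega)}$ and $(\hat g_n)_j=(g_n,\varphi_j)_{L^2(\partial\Omega)}$, $j\in\mathcal N$. Let $\Psi_n\in\mathbb R^{N\times N^2}$ be the block diagonal matrix with $N$ diagonal blocks, each equal to the row vector $\hat\psi_n^T$, let $\Psi\in\mathbb R^{N^2\times N^2}$ consist of all $\Psi_n$, $n\in\mathcal N$, stacked, and let $g\in\mathbb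 R^{N^2}$ consist of all $\hat g_n$, $n\in\mathcal N$, stacked. Assume that $\Psi$ has full rank $N^2$. Then the ND maps $\mathcal R_\sigma$ and $\mathcal R_1$ are well defined (each $\psi\in L^2_\diamond(\partial\Omega)$ determines exactly one boundary voltage $u|_{\partial\Omega}$), the normal equation $$\Psi^T\Psi r=\Psi^T g$$ has a unique solution $r\in\mathbb R^{N^2}$, and this solution is the vector whose consecutive blocks are the rows of the full-boundary difference ND matrix $\mathbf R_{\sigma,1}\in\mathbb R^{N\times N}$ of order $N$, $(\mathbf R_{\sigma,1})_{n,j}=(\mathcal R_{\sigma,1}\varphi_n,\varphi_j)_{L^2(\partial\Omega)}$. -/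

import Mathlib

open MeasureTheory Filter Topology
open scoped ENNReal ContDiff Gradient

namespace EIT

instance factTwoPiPos : Fact (0 < 2 * Real.pi) := ⟨Real.two_pi_pos⟩

/-! ### The unit disk, its boundary, and the spaces `L²(Ω)`, `L²(∂Ω)`, `L²_⋄(∂Ω)` -/

/-- The plane is identified with `ℂ`; `Ω` is the open unit disk. -/
def disk : Set ℂ := Metric.ball 0 1

/-- Lebesgue measure on `Ω`. -/
noncomputable abbrev diskMeasure : Measure ℂ := volume.restrict disk

/-- The unit circle `∂Ω`, parametrised by the angle `θ ∈ ℝ / 2πℤ`. Its `volume` is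
arc length (total mass `2π`). -/
abbrev Bdry : Type := AddCircle (2 * Real.pi)

/-- The point `e^{iθ}` of the plane. -/
noncomputable def bdryPoint (θ : Bdry) : ℂ := (AddCircle.toCircle θ : ℂ)

theorem bdryPoint_coe (t : ℝ) : bdryPoint (t : Bdry) = Complex.exp (t * Complex.I) := by
  have h : 2 * Real.pi ≠ 0 := Real.two_pi_pos.ne'
  rw [bdryPoint, AddCircle.toCircle_apply_mk, Circle.coe_exp, div_self h, one_mul]

/-- `L²(Ω)`. -/
abbrev L2Disk : Type := Lp ℝ 2 diskMeasure

/-- `L²(Ω; ℝ²)`, the space of square integrable vector fields. -/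
abbrev L2DiskVec : Type := Lp ℂ 2 diskMeasure

/-- `L²(∂Ω)`. -/
abbrev L2Bdry : Type := Lp ℝ 2 (volume : Measure Bdry)

theorem integrable_L2Bdry (f : L2Bdry) : Integrable (f : Bdry → ℝ) volume :=
  (Lp.memLp f).integrable (by norm_num)

/-- `L²_⋄(∂Ω)`, the mean free functions in `L²(∂Ω)`. -/
noncomputable def L2Diamond : Submodule ℝ L2Bdry where
  carrier := {f | ∫ θ, f θ = 0}
  zero_mem' := by
    change ∫ θ, (0 : L2Bdry) θ = 0
    rw [integral_congr_ae (Lp.coeFn_zero ℝ 2 (volume : Measure Bdry))]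
    simp
  add_mem' := by
    intro f g hf hg
    change ∫ θ, (f + g : L2Bdry) θ = 0
    rw [integral_congr_ae (Lp.coeFn_add f g)]
    simp only [Pi.add_apply]
    rw [integral_add (integrable_L2Bdry f) (integrable_L2Bdry g)]
    change ∫ θ, f θ = 0 at hf
    change ∫ θ, g θ = 0 at hg
    rw [hf, hg, add_zero]
  smul_mem' := by
    intro c f hf
    change ∫ θ, (c • f : L2Bdry) θ = 0
    rw [integral_congr_ae (Lp.coeFn_smul c f)]
    simp only [Pi.smul_apply, smul_eq_mul]
    change ∫ θ, f θ = 0 at hf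
    rw [integral_const_mul, hf, mul_zero]

theorem mem_L2Diamond (f : L2Bdry) : f ∈ L2Diamond ↔ ∫ θ, f θ = 0 := Iff.rfl

/-! ### Conductivities -/

/-- `σ ∈ L^∞(Ω)` is strictly positive, i.e. bounded from below by a positive constant. -/
structure IsConductivity (σ : ℂ → ℝ) : Prop where
  memLp : MemLp σ ∞ diskMeasure
  strictlyPos : ∃ c > 0, ∀ᵐ z ∂diskMeasure, c ≤ σ z

/-- `σ(z) = σ(|z|)` (for almost every `z ∈ Ω`). -/
def IsRotSymmetric (σ : ℂ → ℝ) : Prop :=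
  ∃ ρ : ℝ → ℝ, ∀ᵐ z ∂diskMeasure, σ z = ρ ‖z‖

/-- `σ ≡ 1` in a neighbourhood of the boundary. -/
def IsOneNearBoundary (σ : ℂ → ℝ) : Prop :=
  ∃ δ > 0, ∀ᵐ z ∂diskMeasure, 1 - δ < ‖z‖ → σ z = 1

/-! ### `H¹(Ω)`, traces and the Neumann problem -/

/-- `u ∈ H¹(Ω)` with weak gradient `G`. -/
def IsWeakGradient (u : L2Disk) (G : L2DiskVec) : Prop :=
  ∀ φ : ℂ → ℝ, ContDiff ℝ ∞ φ → HasCompactSupport φ → tsupport φ ⊆ disk →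
    ∫ z in disk, u z • ∇ φ z = - ∫ z in disk, φ z • G z

/-- `f` is the boundary trace of the function `u ∈ H¹(Ω)` with gradient `G`: the trace operator
`H¹(Ω) → L²(∂Ω)` is the continuous extension of the restriction `v ↦ v|_{∂Ω}` of functions `v`
that are smooth up to the boundary. -/
def HasTrace (u : L2Disk) (G : L2DiskVec) (f : L2Bdry) : Prop :=
  ∃ v : ℕ → ℂ → ℝ, (∀ k, ContDiff ℝ ∞ (v k)) ∧
    Tendsto (fun k => eLpNorm (fun z => v k z - u z) 2 diskMeasure) atTop (𝓝 0) ∧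
    Tendsto (fun k => eLpNorm (fun z => ∇ (v k) z - G z) 2 diskMeasure) atTop (𝓝 0) ∧
    Tendsto (fun k => eLpNorm (fun θ => v k (bdryPoint θ) - f θ) 2 (volume : Measure Bdry))
      atTop (𝓝 0)

/-- `u` (with gradient `G` and trace `f`) is the weak solution of `∇·σ∇u = 0` in `Ω`,
`σ ∂u/∂ν = ψ` on `∂Ω`, normalised by `∫_{∂Ω} u ds = 0`. -/
structure IsNeumannSolution (σ : ℂ → ℝ) (ψ : L2Bdry) (u : L2Disk) (G : L2DiskVec)
    (f : L2Bdry) : Prop where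
  weakGradient : IsWeakGradient u G
  trace : HasTrace u G f
  weakForm : ∀ (v : L2Disk) (H : L2DiskVec) (h : L2Bdry), IsWeakGradient v H → HasTrace v H h →
    ∫ z in disk, σ z * inner ℝ (G z) (H z) = ∫ θ, ψ θ * h θ
  meanFree : ∫ θ, f θ = 0

/-- `f` is the boundary trace of a weak solution of the Neumann problem with current `ψ`. -/
def IsNDValue (σ : ℂ → ℝ) (ψ f : L2Diamond) : Prop :=
  ∃ (u : L2Disk) (G : L2DiskVec), IsNeumannSolution σ (ψ : L2Bdry) u G (f : L2Bdry)

/-- The Neumann problem is well posed on the level of boundary data: every mean free current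
determines exactly one boundary voltage. -/
def NDWellDefined (σ : ℂ → ℝ) : Prop :=
  ∀ ψ : L2Diamond, ∃! f : L2Diamond, IsNDValue σ ψ f

open Classical in
/-- The Neumann-to-Dirichlet map `R_σ : L²_⋄(∂Ω) → L²_⋄(∂Ω)`, `R_σ ψ = u|_{∂Ω}`. -/
noncomputable def NDMap (σ : ℂ → ℝ) (ψ : L2Diamond) : L2Diamond :=
  if h : ∃ f : L2Diamond, IsNDValue σ ψ f then h.choose else 0

/-- The difference map `R_{σ,1} = R_σ - R_1`. -/
noncomputable def NDDiff (σ : ℂ → ℝ) (ψ : L2Diamond) : L2Diamond :=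
  NDMap σ ψ - NDMap (fun _ => 1) ψ

/-! ### Electrodes and the nonorthogonal projection -/

/-- `M` mutually disjoint open connected electrodes of equal size on the circle, together with
extended electrodes that cover the circle up to their end points. -/
structure Electrodes (M : ℕ) where
  E : Fin M → Set Bdry
  isOpen_E : ∀ m, IsOpen (E m)
  isConnected_E : ∀ m, IsConnected (E m)
  disjoint_E : Pairwise fun m m' => Disjoint (E m) (E m')
  sameSize : ∀ m m', volume (E m) = volume (E m')
  Ext : Fin M → Set Bdry
  isOpen_Ext : ∀ m, IsOpen (Ext m)
  isConnected_Ext : ∀ m, IsConnected (Ext m)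
  disjoint_Ext : Pairwise fun m m' => Disjoint (Ext m) (Ext m')
  subset_Ext : ∀ m, E m ⊆ closure (Ext m)
  cover : ⋃ m, closure (Ext m) = Set.univ

/-- The nonorthogonal projection `Q φ = ∑ₘ (χₘ / |Eₘ|) ∫_{Ẽₘ} φ ds`. -/
noncomputable def nonorthProj {M : ℕ} (el : Electrodes M) (φ : L2Bdry) : L2Bdry :=
  ∑ m, ((∫ θ in el.Ext m, φ θ) / volume.real (el.E m)) •
    indicatorConstLp 2 (el.isOpen_E m).measurableSet (measure_ne_top volume (el.E m)) (1 : ℝ)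

theorem volume_frontier_eq_zero {S : Set Bdry} (hS : IsOpen S) (hc : IsConnected S) :
    volume (frontier S) = 0 := by
  by_cases hu : S = Set.univ
  · simp [hu]
  obtain ⟨x₀, hx₀⟩ := (Set.ne_univ_iff_exists_notMem S).1 hu
  obtain ⟨a, rfl⟩ := QuotientAddGroup.mk_surjective x₀
  change (a : Bdry) ∉ S at hx₀
  set f : Bdry → ℝ := fun x => (AddCircle.equivIoc (2 * Real.pi) a x : ℝ) with hf
  have hcont : ∀ x : Bdry, x ≠ a → ContinuousAt f x := fun x hx =>
    continuous_subtype_val.continuousAt.comp (AddCircle.continuousAt_equivIoc _ a hx)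
  have hinj : Function.Injective f :=
    Subtype.val_injective.comp (AddCircle.equivIoc (2 * Real.pi) a).injective
  have hpre : IsPreconnected (f '' S) := hc.isPreconnected.image f fun x hx =>
    (hcont x (fun h => hx₀ (h ▸ hx))).continuousWithinAt
  have hnull : volume (frontier (f '' S)) = 0 :=
    (Real.convex_iff_isPreconnected.2 hpre).addHaar_frontier volume
  have hsub : frontier S ⊆ {(a : Bdry)} ∪ f ⁻¹' frontier (f '' S) := by
    intro x hx
    by_cases hxa : x = a
    · exact Or.inl hxa
    refine Or.inr ⟨?_, ?_⟩
    · exact (hcont x hxa).continuousWithinAt.mem_closure_image hx.1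
    · intro hxi
      obtain ⟨y, hy, hyx⟩ := interior_subset hxi
      rw [hS.frontier_eq] at hx
      exact hx.2 (hinj hyx ▸ hy)
  have hmp : MeasurePreserving f volume (volume.restrict (Set.Ioc a (a + 2 * Real.pi))) :=
    (measurePreserving_subtype_coe measurableSet_Ioc).comp
      (AddCircle.measurePreserving_equivIoc (T := 2 * Real.pi) (a := a))
  have h0 : volume ({(a : Bdry)} : Set Bdry) = 0 := by
    rw [← Metric.closedBall_zero, AddCircle.volume_closedBall]
    simp [Real.two_pi_pos.le]
  refine measure_mono_null hsub (measure_union_null h0 ?_)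
  rw [hmp.measure_preimage isClosed_frontier.measurableSet.nullMeasurableSet]
  exact le_antisymm ((Measure.restrict_apply_le _ _).trans hnull.le) bot_le

theorem Electrodes.volume_E_pos {M : ℕ} (el : Electrodes M) (m : Fin M) :
    0 < volume.real (el.E m) :=
  ENNReal.toReal_pos ((el.isOpen_E m).measure_pos volume (el.isConnected_E m).nonempty).ne'
    (measure_ne_top _ _)

theorem integral_nonorthProj {M : ℕ} (el : Electrodes M) (φ : L2Bdry) :
    ∫ θ, nonorthProj el φ θ = ∫ θ, φ θ := by
  have h1 : (nonorthProj el φ : Bdry → ℝ) =ᵐ[volume] fun θ => ∑ m,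
      ((∫ θ in el.Ext m, φ θ) / volume.real (el.E m)) * (el.E m).indicator (fun _ => (1 : ℝ)) θ := by
    have h2 : ∀ m, ∀ᵐ θ : Bdry, (((∫ θ in el.Ext m, φ θ) / volume.real (el.E m)) •
        indicatorConstLp 2 (el.isOpen_E m).measurableSet (measure_ne_top volume (el.E m)) (1 : ℝ) :
          L2Bdry) θ = ((∫ θ in el.Ext m, φ θ) / volume.real (el.E m)) *
            (el.E m).indicator (fun _ => (1 : ℝ)) θ := by
      intro m
      filter_upwards [Lp.coeFn_smul ((∫ θ in el.Ext m, φ θ) / volume.real (el.E m))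
        (indicatorConstLp 2 (el.isOpen_E m).measurableSet (measure_ne_top volume (el.E m)) (1 : ℝ)),
        indicatorConstLp_coeFn (p := 2) (hs := (el.isOpen_E m).measurableSet)
          (hμs := measure_ne_top volume (el.E m)) (c := (1 : ℝ))] with θ h3 h4
      rw [h3, Pi.smul_apply, h4, smul_eq_mul]
    filter_upwards [Lp.coeFn_finsetSum (p := 2) (μ := (volume : Measure Bdry)) Finset.univ
      (fun m => (((∫ θ in el.Ext m, φ θ) / volume.real (el.E m)) •
        indicatorConstLp 2 (el.isOpen_E m).measurableSet (measure_ne_top volume (el.E m)) (1 : ℝ) :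
          L2Bdry)), ae_all_iff.2 h2] with θ h5 h6
    rw [nonorthProj, h5]
    simp only [Finset.sum_apply]
    exact Finset.sum_congr rfl fun m _ => h6 m
  have h7 : ∀ m, ∫ θ, ((∫ θ in el.Ext m, φ θ) / volume.real (el.E m)) *
      (el.E m).indicator (fun _ => (1 : ℝ)) θ = ∫ θ in el.Ext m, φ θ := by
    intro m
    rw [integral_const_mul, integral_indicator (el.isOpen_E m).measurableSet, setIntegral_const,
      smul_eq_mul, mul_one, div_mul_cancel₀ _ (el.volume_E_pos m).ne']
  rw [integral_congr_ae h1, integral_finsetSum _ fun m _ => ?_, Finset.sum_congr rfl fun m _ => h7 m]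
  · rw [← integral_iUnion_fintype (fun m => (el.isOpen_Ext m).measurableSet) el.disjoint_Ext
      fun m => (integrable_L2Bdry φ).integrableOn]
    refine Eq.trans (setIntegral_congr_set ?_) (setIntegral_univ (μ := volume) (f := (φ : Bdry → ℝ)))
    rw [ae_eq_univ]
    refine measure_mono_null (t := ⋃ m, frontier (el.Ext m)) ?_
      (measure_iUnion_null fun m => volume_frontier_eq_zero (el.isOpen_Ext m) (el.isConnected_Ext m))
    intro x hx
    have hx' : x ∈ ⋃ m, closure (el.Ext m) := by rw [el.cover]; trivial
    obtain ⟨m, hm⟩ := Set.mem_iUnion.1 hx'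
    refine Set.mem_iUnion.2 ⟨m, ?_⟩
    rw [(el.isOpen_Ext m).frontier_eq]
    exact ⟨hm, fun h => hx (Set.mem_iUnion.2 ⟨m, h⟩)⟩
  · exact ((integrable_const (1 : ℝ)).indicator (el.isOpen_E m).measurableSet).const_mul _

/-- The nonorthogonal projection as a map `L²_⋄(∂Ω) → L²_⋄(∂Ω)`. -/
noncomputable def nonorthProjDiamond {M : ℕ} (el : Electrodes M) (φ : L2Diamond) : L2Diamond :=
  ⟨nonorthProj el φ, by rw [mem_L2Diamond, integral_nonorthProj]; exact φ.2⟩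

/-! ### The trigonometric basis -/

/-- The index set `{-N/2, …, -1, 1, …, N/2}` (`N` even). -/
abbrev Idx (N : ℕ) : Type := {n : ℤ // n ∈ (Finset.Icc (-((N : ℤ) / 2)) ((N : ℤ) / 2)).erase 0}

/-- `π^{-1/2} sin(n t)` for `n < 0` and `π^{-1/2} cos(n t)` for `n > 0`. -/
noncomputable def trigReal (n : ℤ) (t : ℝ) : ℝ :=
  if n < 0 then Real.sin (n * t) / √Real.pi else Real.cos (n * t) / √Real.pi

theorem trigReal_periodic (n : ℤ) : Function.Periodic (trigReal n) (2 * Real.pi) := by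
  intro t
  have h : (n : ℝ) * (t + 2 * Real.pi) = n * t + n * (2 * Real.pi) := by ring
  simp only [trigReal, h, Real.sin_add_int_mul_two_pi, Real.cos_add_int_mul_two_pi]

/-- The function `φ_n` on the circle. -/
noncomputable def trigFun (n : ℤ) : Bdry → ℝ := (trigReal_periodic n).lift

theorem trigFun_coe (n : ℤ) (t : ℝ) : trigFun n (t : Bdry) = trigReal n t := rfl

theorem continuous_trigFun (n : ℤ) : Continuous (trigFun n) := by
  refine continuous_coinduced_dom.2 ?_
  change Continuous (trigReal n)
  unfold trigReal
  split_ifs <;> fun_prop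

theorem memLp_trigFun (n : ℤ) : MemLp (trigFun n) 2 (volume : Measure Bdry) :=
  (continuous_trigFun n).memLp_of_hasCompactSupport
    (HasCompactSupport.of_compactSpace _)

theorem integral_trigFun {n : ℤ} (hn : n ≠ 0) : ∫ θ, trigFun n θ = 0 := by
  have hn' : (n : ℝ) ≠ 0 := by exact_mod_cast hn
  rw [← AddCircle.intervalIntegral_preimage (2 * Real.pi) 0]
  simp only [trigFun_coe, trigReal]
  split_ifs
  · rw [intervalIntegral.integral_div,
      intervalIntegral.integral_comp_mul_left (fun x => Real.sin x) hn', integral_sin]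
    have h : (n : ℝ) * (0 + 2 * Real.pi) = 0 + n * (2 * Real.pi) := by ring
    rw [h, Real.cos_add_int_mul_two_pi]
    simp
  · rw [intervalIntegral.integral_div,
      intervalIntegral.integral_comp_mul_left (fun x => Real.cos x) hn', integral_cos]
    have h : (n : ℝ) * (0 + 2 * Real.pi) = 0 + n * (2 * Real.pi) := by ring
    rw [h, Real.sin_add_int_mul_two_pi]
    simp

/-- The basis function `φ_n ∈ L²_⋄(∂Ω)`, `n ≠ 0`. -/
noncomputable def trigBasis {N : ℕ} (n : Idx N) : L2Diamond :=
  ⟨(memLp_trigFun n).toLp _, by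
    rw [mem_L2Diamond, integral_congr_ae (memLp_trigFun n).coeFn_toLp]
    exact integral_trigFun (Finset.ne_of_mem_erase n.2)⟩

/-! ### The matrices and vectors of the reconstruction problem -/

/-- The partial-boundary current `ψ_n = Q φ_n`. -/
noncomputable def current {M N : ℕ} (el : Electrodes M) (n : Idx N) : L2Diamond :=
  nonorthProjDiamond el (trigBasis n)

/-- The measurement `g_n = R_{σ,1} ψ_n`. -/
noncomputable def measurement {M N : ℕ} (el : Electrodes M) (σ : ℂ → ℝ) (n : Idx N) : L2Diamond :=
  NDDiff σ (current el n)

/-- The coefficients `(f, φ_j)_{L²(∂Ω)}`. -/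
noncomputable def coeff {N : ℕ} (f : L2Diamond) (j : Idx N) : ℝ :=
  inner ℝ (f : L2Bdry) (trigBasis j : L2Bdry)

/-- The full-boundary difference ND matrix of order `N`: `(R_{σ,1})_{n,j} = (R_{σ,1} φ_n, φ_j)`. -/
noncomputable def ndMatrix (N : ℕ) (σ : ℂ → ℝ) : Matrix (Idx N) (Idx N) ℝ :=
  Matrix.of fun n j => coeff (NDDiff σ (trigBasis n)) j

/-- The vector of length `N²` whose consecutive blocks are the rows of a matrix. -/
def vecRows {N : ℕ} (R : Matrix (Idx N) (Idx N) ℝ) : Idx N × Idx N → ℝ := fun p => R p.1 p.2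

/-- The `N × N²` block diagonal matrix with `N` diagonal blocks, each the row vector `ψ̂_nᵀ`. -/
noncomputable def PsiBlock {M N : ℕ} (el : Electrodes M) (n : Idx N) :
    Matrix (Idx N) (Idx N × Idx N) ℝ :=
  Matrix.of fun j p => if p.1 = j then coeff (current el n) p.2 else 0

/-- The `N² × N²` matrix `Ψ`, all the `Ψ_n` stacked. -/
noncomputable def Psi {M : ℕ} (N : ℕ) (el : Electrodes M) :
    Matrix (Idx N × Idx N) (Idx N × Idx N) ℝ :=
  Matrix.of fun p q => PsiBlock el p.1 p.2 q

/-- The vector `g ∈ ℝ^{N²}`, all the coefficient vectors `ĝ_n` stacked. -/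
noncomputable def gVec {M : ℕ} (N : ℕ) (el : Electrodes M) (σ : ℂ → ℝ) : Idx N × Idx N → ℝ :=
  fun p => coeff (measurement el σ p.1) p.2

end EIT

open EIT

/-!
The Neumann problem is solved in the Hilbert space `sobolev`, the closure of the triples
`(v, ∇v, v|_{∂Ω})` of smooth functions `v` in `L²(Ω) × L²(Ω; ℝ²) × L²(∂Ω)`. By `hasTrace_iff` this
is the same as the sequential definition of the trace, and by `isWeakGradient_of_mem_sobolev` its
elements have the expected weak gradient. Polar coordinates give, for smooth functions and then
by closure, that gradient and mean of the trace control the whole triple (`norm_sq_tr_le`,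
`norm_sq_fn_le`). The energy form is therefore coercive on the triples with mean free trace, so that
Lax-Milgram yields existence and coercivity yields uniqueness (`ndWellDefined`). The map `R_σ` is
linear and, the energy form being symmetric, `R_σ` is symmetric (`inner_NDMap_comm`).

For rotationally symmetric `σ` the map `R_σ` commutes with rotations and with the reflection
`θ ↦ -θ` (`DiskSymmetry.NDMap_comp`). The addition formulas of `sin` and `cos` turn this into a
functional equation for `R_σ φ_n`, which by Fubini's theorem forces `R_σ φ_n` into the span of `φ_n`
and `φ_{-n}`; by parity it is a multiple of `φ_n` (`exists_NDMap_trigDiamond`).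

Hence `R_{σ,1} φ_j = λ_j φ_j` for some `λ_j`, and by symmetry
`(R_{σ,1} ψ_n, φ_j) = (ψ_n, R_{σ,1} φ_j) = λ_j (ψ_n, φ_j)`. Since the matrix of `R_{σ,1}` is diagonal
with entries `λ_j`, this says that the stacked rows of the matrix solve `Ψ r = g` exactly
(`Psi_mulVec_vecRows`), and full rank of `Ψ` makes the solution of the normal equation unique.
-/

namespace EIT

/-! ### Polar coordinates and the a priori estimates for smooth functions -/

/-- The point of the plane with polar coordinates `(r, t)`. -/
noncomputable def polarPoint (r t : ℝ) : ℂ := r * Complex.exp (t * Complex.I)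

theorem continuous_polarPoint : Continuous (fun p : ℝ × ℝ => polarPoint p.1 p.2) := by
  unfold polarPoint; fun_prop

theorem continuous_polarPoint_left (t : ℝ) : Continuous fun r : ℝ => polarPoint r t := by
  unfold polarPoint; fun_prop

theorem continuous_polarPoint_right (r : ℝ) : Continuous fun t : ℝ => polarPoint r t := by
  unfold polarPoint; fun_prop

theorem norm_polarPoint {r : ℝ} (hr : 0 ≤ r) (t : ℝ) : ‖polarPoint r t‖ = r := by
  rw [polarPoint, norm_mul, Complex.norm_exp_ofReal_mul_I, mul_one, Complex.norm_real,
    Real.norm_of_nonneg hr]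

theorem bdryPoint_eq_polarPoint (t : ℝ) : bdryPoint (t : Bdry) = polarPoint 1 t := by
  simp [bdryPoint_coe, polarPoint]

theorem measurableSet_disk : MeasurableSet disk := Metric.isOpen_ball.measurableSet

theorem integral_disk_eq_polar {F : ℂ → ℝ} (hF : Continuous F) :
    ∫ z in disk, F z =
      ∫ r in (0 : ℝ)..1, ∫ t in (-Real.pi)..Real.pi, r * F (polarPoint r t) := by
  have hc : Continuous (fun p : ℝ × ℝ => p.1 * F (polarPoint p.1 p.2)) :=
    continuous_fst.mul (hF.comp continuous_polarPoint)
  have hpt : ∀ p : ℝ × ℝ, Complex.polarCoord.symm p = polarPoint p.1 p.2 := fun p => by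
    rw [Complex.polarCoord_symm_apply, polarPoint, Complex.exp_mul_I, Complex.ofReal_cos,
      Complex.ofReal_sin]
  rw [← integral_indicator measurableSet_disk,
    ← Complex.integral_comp_polarCoord_symm]
  have hset : polarCoord.target ∩ {p : ℝ × ℝ | p.1 < 1} =
      Set.Ioo 0 1 ×ˢ Set.Ioo (-Real.pi) Real.pi := by
    ext p
    simp only [polarCoord_target, Set.mem_inter_iff, Set.mem_prod, Set.mem_Ioi, Set.mem_Ioo,
      Set.mem_ofPred_eq]
    tauto
  have hm : MeasurableSet {p : ℝ × ℝ | p.1 < 1} := measurableSet_lt measurable_fst measurable_const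
  have h1 : ∫ p in polarCoord.target, p.1 • disk.indicator F (Complex.polarCoord.symm p) =
      ∫ p in polarCoord.target, {p : ℝ × ℝ | p.1 < 1}.indicator
        (fun p => p.1 * F (polarPoint p.1 p.2)) p := by
    refine setIntegral_congr_fun polarCoord.open_target.measurableSet fun p hp => ?_
    have hp0 : 0 < p.1 := by
      simp only [polarCoord_target, Set.mem_prod, Set.mem_Ioi] at hp
      exact hp.1
    have hmem : polarPoint p.1 p.2 ∈ disk ↔ p.1 < 1 := by
      rw [disk, mem_ball_zero_iff, norm_polarPoint hp0.le]
    simp only [hpt, smul_eq_mul]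
    by_cases hp1 : p.1 < 1
    · rw [Set.indicator_of_mem (hmem.2 hp1), Set.indicator_of_mem (s := {p : ℝ × ℝ | p.1 < 1}) hp1]
    · rw [Set.indicator_of_notMem (mt hmem.1 hp1),
        Set.indicator_of_notMem (s := {p : ℝ × ℝ | p.1 < 1}) hp1, mul_zero]
  rw [h1, setIntegral_indicator hm, hset, Measure.volume_eq_prod, setIntegral_prod]
  · rw [intervalIntegral.integral_of_le zero_le_one, integral_Ioc_eq_integral_Ioo]
    refine setIntegral_congr_fun measurableSet_Ioo fun r _ => ?_
    simp only
    rw [intervalIntegral.integral_of_le (by linarith [Real.pi_pos]), integral_Ioc_eq_integral_Ioo]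
  · rw [← Measure.volume_eq_prod]
    refine IntegrableOn.mono_set (t := Set.Icc 0 1 ×ˢ Set.Icc (-Real.pi) Real.pi) ?_
      (Set.prod_mono Set.Ioo_subset_Icc_self Set.Ioo_subset_Icc_self)
    exact hc.continuousOn.integrableOn_compact (isCompact_Icc.prod isCompact_Icc)

theorem intervalIntegral_comm {g : ℝ → ℝ → ℝ} (hg : Continuous (Function.uncurry g))
    (a b c d : ℝ) : ∫ r in a..b, ∫ t in c..d, g r t = ∫ t in c..d, ∫ r in a..b, g r t := by
  refine intervalIntegral_intervalIntegral_swap ?_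
  exact (hg.continuousOn.integrableOn_compact (isCompact_uIcc.prod isCompact_uIcc)).mono_set
    (Set.prod_mono Set.uIoc_subset_uIcc Set.uIoc_subset_uIcc)

theorem integral_bdry_eq (F : Bdry → ℝ) :
    ∫ θ, F θ = ∫ t in (-Real.pi)..Real.pi, F (t : Bdry) := by
  rw [← AddCircle.intervalIntegral_preimage (2 * Real.pi) (-Real.pi) F]
  congr 1; ring

/-- The Cauchy-Schwarz inequality on an interval, from the non-negativity of the variance. -/
theorem sq_intervalIntegral_le {h : ℝ → ℝ} (hh : Continuous h) {a b : ℝ} (hab : a ≤ b) :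
    (∫ s in a..b, h s) ^ 2 ≤ (b - a) * ∫ s in a..b, h s ^ 2 := by
  rcases hab.eq_or_lt with rfl | hlt
  · simp
  set I := ∫ s in a..b, h s
  have hi : ∀ k : ℝ → ℝ, Continuous k → IntervalIntegrable k volume a b :=
    fun k hk => hk.intervalIntegrable a b
  have h0 : 0 ≤ ∫ s in a..b, (h s - I / (b - a)) ^ 2 :=
    intervalIntegral.integral_nonneg hab fun s _ => sq_nonneg _
  have h1 : ∫ s in a..b, (h s - I / (b - a)) ^ 2 =
      (∫ s in a..b, h s ^ 2) - 2 * (I / (b - a)) * I + (b - a) * (I / (b - a)) ^ 2 := by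
    have : ∀ s, (h s - I / (b - a)) ^ 2 =
        h s ^ 2 - 2 * (I / (b - a)) * h s + (I / (b - a)) ^ 2 := fun s => by ring
    simp only [this]
    rw [intervalIntegral.integral_add (hi _ (by fun_prop)) (hi _ (by fun_prop)),
      intervalIntegral.integral_sub (hi _ (by fun_prop)) (hi _ (by fun_prop)),
      intervalIntegral.integral_const_mul, intervalIntegral.integral_const, smul_eq_mul]
  have hd : 0 < b - a := by linarith
  rw [h1] at h0
  have h2 : (∫ s in a..b, h s ^ 2) - 2 * (I / (b - a)) * I + (b - a) * (I / (b - a)) ^ 2 =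
      (∫ s in a..b, h s ^ 2) - I ^ 2 / (b - a) := by field_simp; ring
  rw [h2, sub_nonneg, div_le_iff₀ hd] at h0
  linarith

theorem continuous_gradient {v : ℂ → ℝ} (hv : ContDiff ℝ ∞ v) : Continuous (∇ v) :=
  (InnerProductSpace.toDual ℝ ℂ).symm.continuous.comp (hv.continuous_fderiv (by simp))

theorem fderiv_sq_le (v : ℂ → ℝ) (z w : ℂ) :
    (fderiv ℝ v z w) ^ 2 ≤ ‖w‖ ^ 2 * ‖∇ v z‖ ^ 2 := by
  rw [← inner_gradient_left, ← mul_pow, mul_comm, ← sq_abs]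
  exact pow_le_pow_left₀ (abs_nonneg _) (abs_real_inner_le_norm _ _) 2

section Estimates

variable {v : ℂ → ℝ} (hv : ContDiff ℝ ∞ v)

include hv

theorem continuous_normSq_gradient_polar :
    Continuous (Function.uncurry fun r t : ℝ => ‖∇ v (polarPoint r t)‖ ^ 2) :=
  ((continuous_gradient hv).comp continuous_polarPoint).norm.pow 2

/-- The factor `r` on the left absorbs the Jacobian of polar coordinates on the right. -/
theorem radial_increment_sq_le {r : ℝ} (hr0 : 0 ≤ r) (hr1 : r ≤ 1) (t : ℝ) :
    r * (v (polarPoint 1 t) - v (polarPoint r t)) ^ 2 ≤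
      ∫ s in (0 : ℝ)..1, s * ‖∇ v (polarPoint s t)‖ ^ 2 := by
  set g : ℝ → ℝ := fun s => ‖∇ v (polarPoint s t)‖ ^ 2
  have hg : Continuous g :=
    ((continuous_gradient hv).comp (continuous_polarPoint_left t)).norm.pow 2
  set e : ℂ := Complex.exp (t * Complex.I)
  have he : ‖e‖ = 1 := Complex.norm_exp_ofReal_mul_I t
  have hd : ∀ s : ℝ, HasDerivAt (fun s => v (polarPoint s t))
      (fderiv ℝ v (polarPoint s t) e) s := by
    intro s
    have h1 : HasDerivAt (fun s : ℝ => polarPoint s t) e s := by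
      simpa [polarPoint, e] using ((hasDerivAt_id s).ofReal_comp).mul_const e
    have h3 : HasFDerivAt v (fderiv ℝ v (polarPoint s t)) (polarPoint s t) :=
      (hv.differentiable (by simp) _).hasFDerivAt
    exact HasFDerivAt.comp_hasDerivAt (f := fun s => polarPoint s t) s h3 h1
  have hcd : Continuous fun s : ℝ => fderiv ℝ v (polarPoint s t) e :=
    ((hv.continuous_fderiv (by simp)).comp (continuous_polarPoint_left t)).clm_apply
      continuous_const
  have hftc := intervalIntegral.integral_eq_sub_of_hasDerivAt (a := r) (b := 1)
    (fun s _ => hd s) (hcd.intervalIntegrable _ _)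
  rw [← hftc]
  have h2 : (∫ s in r..1, fderiv ℝ v (polarPoint s t) e) ^ 2 ≤ ∫ s in r..1, g s := by
    calc _ ≤ (1 - r) * ∫ s in r..1, (fderiv ℝ v (polarPoint s t) e) ^ 2 :=
          sq_intervalIntegral_le hcd hr1
      _ ≤ 1 * ∫ s in r..1, (fderiv ℝ v (polarPoint s t) e) ^ 2 :=
          mul_le_mul_of_nonneg_right (by linarith)
            (intervalIntegral.integral_nonneg hr1 fun s _ => sq_nonneg _)
      _ ≤ _ := by
          rw [one_mul]
          refine intervalIntegral.integral_mono_on hr1 ((hcd.pow 2).intervalIntegrable _ _)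
            (hg.intervalIntegrable _ _) fun s _ => ?_
          simpa [he] using fderiv_sq_le v (polarPoint s t) e
  calc r * _ ≤ r * ∫ s in r..1, g s := mul_le_mul_of_nonneg_left h2 hr0
    _ = ∫ s in r..1, r * g s := (intervalIntegral.integral_const_mul _ _).symm
    _ ≤ ∫ s in r..1, s * g s :=
        intervalIntegral.integral_mono_on hr1 ((continuous_const.mul hg).intervalIntegrable _ _)
          ((continuous_id.mul hg).intervalIntegrable _ _) fun s hs =>
            mul_le_mul_of_nonneg_right hs.1 (sq_nonneg _)
    _ ≤ ∫ s in (0 : ℝ)..1, s * g s := by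
        have hsg : Continuous fun s => s * g s := continuous_id.mul hg
        rw [← intervalIntegral.integral_add_adjacent_intervals
          (hsg.intervalIntegrable 0 r) (hsg.intervalIntegrable r 1)]
        exact le_add_of_nonneg_left (intervalIntegral.integral_nonneg hr0 fun s hs =>
          mul_nonneg hs.1 (sq_nonneg _))

theorem angular_increment_sq_le {r : ℝ} (hr0 : 0 ≤ r) (hr1 : r ≤ 1) {t : ℝ}
    (ht : t ∈ Set.Icc (-Real.pi) Real.pi) :
    (v (polarPoint r t) - v (polarPoint r (-Real.pi))) ^ 2 ≤
      2 * Real.pi * ∫ s in (-Real.pi)..Real.pi, r * ‖∇ v (polarPoint r s)‖ ^ 2 := by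
  set g : ℝ → ℝ := fun s => ‖∇ v (polarPoint r s)‖ ^ 2
  have hg : Continuous g := 
    ((continuous_gradient hv).comp (continuous_polarPoint_right r)).norm.pow 2
  set w : ℝ → ℂ := fun s => r * (Complex.exp (s * Complex.I) * Complex.I)
  have hw : ∀ s, ‖w s‖ = r := fun s => by
    simp [w, Complex.norm_exp_ofReal_mul_I, abs_of_nonneg hr0]
  have hd : ∀ s : ℝ, HasDerivAt (fun s => v (polarPoint r s))
      (fderiv ℝ v (polarPoint r s) (w s)) s := by
    intro s
    have h1 : HasDerivAt (fun s : ℝ => polarPoint r s) (w s) s := by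
      have h2 : HasDerivAt (fun s : ℝ => (s : ℂ) * Complex.I) Complex.I s := by
        simpa using ((hasDerivAt_id s).ofReal_comp).mul_const Complex.I
      exact (h2.cexp).const_mul (r : ℂ)
    have h3 : HasFDerivAt v (fderiv ℝ v (polarPoint r s)) (polarPoint r s) :=
      (hv.differentiable (by simp) _).hasFDerivAt
    exact HasFDerivAt.comp_hasDerivAt (f := fun s => polarPoint r s) s h3 h1
  have hcd : Continuous fun s : ℝ => fderiv ℝ v (polarPoint r s) (w s) :=
    ((hv.continuous_fderiv (by simp)).comp (continuous_polarPoint_right r)).clm_apply (by fun_prop)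
  have hftc := intervalIntegral.integral_eq_sub_of_hasDerivAt (a := -Real.pi) (b := t)
    (fun s _ => hd s) (hcd.intervalIntegrable _ _)
  rw [← hftc]
  have hle : ∀ s, (fderiv ℝ v (polarPoint r s) (w s)) ^ 2 ≤ r * g s := fun s => by
    refine (fderiv_sq_le v _ _).trans ?_
    rw [hw]
    exact mul_le_mul_of_nonneg_right (by nlinarith) (sq_nonneg _)
  have hcr : Continuous fun s => r * g s := continuous_const.mul hg
  calc _ ≤ (t - -Real.pi) * ∫ s in (-Real.pi)..t, (fderiv ℝ v (polarPoint r s) (w s)) ^ 2 :=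
        sq_intervalIntegral_le hcd ht.1
    _ ≤ (t - -Real.pi) * ∫ s in (-Real.pi)..t, r * g s :=
        mul_le_mul_of_nonneg_left (intervalIntegral.integral_mono_on ht.1
          ((hcd.pow 2).intervalIntegrable _ _) (hcr.intervalIntegrable _ _) fun s _ => hle s)
          (by linarith [ht.1])
    _ ≤ (2 * Real.pi) * ∫ s in (-Real.pi)..Real.pi, r * g s := by
        refine mul_le_mul (by linarith [ht.2]) ?_ ?_ (by positivity)
        · rw [← intervalIntegral.integral_add_adjacent_intervals
            (hcr.intervalIntegrable (-Real.pi) t) (hcr.intervalIntegrable t Real.pi)]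
          exact le_add_of_nonneg_right (intervalIntegral.integral_nonneg ht.2 fun s _ =>
            mul_nonneg hr0 (sq_nonneg _))
        · exact intervalIntegral.integral_nonneg ht.1 fun s _ => mul_nonneg hr0 (sq_nonneg _)

/-- The trace inequality of Poincaré type. The distance of the boundary values from the constant
`v (polarPoint r (-π))` is split into a radial and an angular increment; averaging over `r`
turns the angular energy on a single circle into the energy on the disk. -/
theorem integral_sq_trace_le :
    ∫ θ, v (bdryPoint θ) ^ 2 ≤ (4 + 16 * Real.pi ^ 2) * (∫ z in disk, ‖∇ v z‖ ^ 2) +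
      (∫ θ, v (bdryPoint θ)) ^ 2 := by
  have hπ := Real.pi_pos
  have hππ : -Real.pi ≤ Real.pi := by linarith
  set E := ∫ z in disk, ‖∇ v z‖ ^ 2
  have hcg : Continuous (Function.uncurry fun r t : ℝ => r * ‖∇ v (polarPoint r t)‖ ^ 2) :=
    continuous_fst.mul (continuous_normSq_gradient_polar hv)
  set A : ℝ → ℝ := fun t => ∫ r in (0 : ℝ)..1, r * ‖∇ v (polarPoint r t)‖ ^ 2
  set B : ℝ → ℝ := fun r => ∫ t in (-Real.pi)..Real.pi, r * ‖∇ v (polarPoint r t)‖ ^ 2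
  have hEB : E = ∫ r in (0 : ℝ)..1, B r :=
    integral_disk_eq_polar ((continuous_gradient hv).norm.pow 2)
  have hEA : E = ∫ t in (-Real.pi)..Real.pi, A t := hEB.trans (intervalIntegral_comm hcg _ _ _ _)
  have hA : Continuous A := intervalIntegral.continuous_parametric_intervalIntegral_of_continuous'
    (f := fun t r => r * ‖∇ v (polarPoint r t)‖ ^ 2) (hcg.comp continuous_swap) 0 1
  have hB : Continuous B :=
    intervalIntegral.continuous_parametric_intervalIntegral_of_continuous' hcg _ _
  set f : ℝ → ℝ := fun t => v (polarPoint 1 t)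
  have hf : Continuous f := hv.continuous.comp (continuous_polarPoint_right 1)
  simp only [integral_bdry_eq, bdryPoint_eq_polarPoint]
  change ∫ t in (-Real.pi)..Real.pi, f t ^ 2 ≤ _ + (∫ t in (-Real.pi)..Real.pi, f t) ^ 2
  set S := ∫ t in (-Real.pi)..Real.pi, f t ^ 2
  set m := ∫ t in (-Real.pi)..Real.pi, f t
  have hi : ∀ k : ℝ → ℝ, Continuous k → IntervalIntegrable k volume (-Real.pi) Real.pi :=
    fun k hk => hk.intervalIntegrable _ _
  -- `∫ f² - m²/2π` is the minimum of `∫ (f - c)²` over all constants `c`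
  have hvar : ∀ c : ℝ, S - m ^ 2 / (2 * Real.pi) ≤ ∫ t in (-Real.pi)..Real.pi, (f t - c) ^ 2 := by
    intro c
    have h1 : ∫ t in (-Real.pi)..Real.pi, (f t - c) ^ 2 = S - 2 * c * m + 2 * Real.pi * c ^ 2 := by
      have : ∀ s, (f s - c) ^ 2 = f s ^ 2 - 2 * c * f s + c ^ 2 := fun s => by ring
      simp only [this]
      rw [intervalIntegral.integral_add (hi _ (by fun_prop)) (hi _ (by fun_prop)),
        intervalIntegral.integral_sub (hi _ (by fun_prop)) (hi _ (by fun_prop)),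
        intervalIntegral.integral_const_mul, intervalIntegral.integral_const, smul_eq_mul]
      ring
    have h2 : S - 2 * c * m + 2 * Real.pi * c ^ 2 - (S - m ^ 2 / (2 * Real.pi)) =
        (2 * Real.pi * c - m) ^ 2 / (2 * Real.pi) := by field_simp; ring
    have h3 : 0 ≤ (2 * Real.pi * c - m) ^ 2 / (2 * Real.pi) := by positivity
    linarith
  have hr : ∀ r ∈ Set.Icc (0 : ℝ) 1,
      r * (S - m ^ 2 / (2 * Real.pi)) ≤ 2 * E + 8 * Real.pi ^ 2 * B r := by
    intro r hr
    set c := v (polarPoint r (-Real.pi))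
    have hB0 : 0 ≤ B r := intervalIntegral.integral_nonneg hππ fun s _ =>
      mul_nonneg hr.1 (sq_nonneg _)
    calc r * (S - m ^ 2 / (2 * Real.pi)) ≤ r * ∫ t in (-Real.pi)..Real.pi, (f t - c) ^ 2 :=
          mul_le_mul_of_nonneg_left (hvar c) hr.1
      _ = ∫ t in (-Real.pi)..Real.pi, r * (f t - c) ^ 2 :=
          (intervalIntegral.integral_const_mul _ _).symm
      _ ≤ ∫ t in (-Real.pi)..Real.pi, (2 * A t + 4 * Real.pi * B r) := by
          refine intervalIntegral.integral_mono_on hππ (hi _ (by fun_prop)) (hi _ (by fun_prop))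
            fun t ht => ?_
          have h1 := radial_increment_sq_le hv hr.1 hr.2 t
          have h2 := angular_increment_sq_le hv hr.1 hr.2 ht
          have h3 : r * (v (polarPoint r t) - c) ^ 2 ≤ 2 * Real.pi * B r :=
            (mul_le_of_le_one_left (sq_nonneg _) hr.2).trans h2
          have h4 : r * (f t - c) ^ 2 ≤ 2 * (r * (f t - v (polarPoint r t)) ^ 2) +
              2 * (r * (v (polarPoint r t) - c) ^ 2) := by
            nlinarith [mul_nonneg hr.1 (sq_nonneg ((f t - v (polarPoint r t)) -
              (v (polarPoint r t) - c)))]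
          change r * (f t - v (polarPoint r t)) ^ 2 ≤ A t at h1
          linarith
      _ = 2 * E + 8 * Real.pi ^ 2 * B r := by
          rw [intervalIntegral.integral_add (hi _ (by fun_prop)) (hi _ (by fun_prop)),
            intervalIntegral.integral_const_mul, intervalIntegral.integral_const, smul_eq_mul,
            ← hEA]
          ring
  have hint := intervalIntegral.integral_mono_on (μ := volume) zero_le_one
    ((by fun_prop : Continuous fun r : ℝ => r * (S - m ^ 2 / (2 * Real.pi))).intervalIntegrable 0 1)
    ((by fun_prop : Continuous fun r => 2 * E + 8 * Real.pi ^ 2 * B r).intervalIntegrable 0 1) hr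
  rw [intervalIntegral.integral_mul_const, intervalIntegral.integral_add
    (continuous_const.intervalIntegrable _ _)
    ((by fun_prop : Continuous fun r => 8 * Real.pi ^ 2 * B r).intervalIntegrable _ _),
    intervalIntegral.integral_const_mul, intervalIntegral.integral_const_mul _ B, ← hEB] at hint
  simp only [integral_id, intervalIntegral.integral_const, smul_eq_mul] at hint
  have hm : m ^ 2 / (2 * Real.pi) ≤ m ^ 2 :=
    div_le_self (sq_nonneg _) (by linarith [Real.pi_gt_three])
  linarith

theorem integral_sq_disk_le :
    ∫ z in disk, v z ^ 2 ≤ 2 * (∫ θ, v (bdryPoint θ) ^ 2) + 2 * ∫ z in disk, ‖∇ v z‖ ^ 2 := by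
  have hππ : -Real.pi ≤ Real.pi := by linarith [Real.pi_pos]
  have hcg : Continuous (Function.uncurry fun r t : ℝ => r * ‖∇ v (polarPoint r t)‖ ^ 2) :=
    continuous_fst.mul (continuous_normSq_gradient_polar hv)
  have hcv : Continuous (Function.uncurry fun r t : ℝ => r * v (polarPoint r t) ^ 2) :=
    continuous_fst.mul ((hv.continuous.comp continuous_polarPoint).pow 2)
  set A : ℝ → ℝ := fun t => ∫ r in (0 : ℝ)..1, r * ‖∇ v (polarPoint r t)‖ ^ 2
  have hA : Continuous A := intervalIntegral.continuous_parametric_intervalIntegral_of_continuous'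
    (f := fun t r => r * ‖∇ v (polarPoint r t)‖ ^ 2) (hcg.comp continuous_swap) 0 1
  have hf : Continuous fun t : ℝ => v (polarPoint 1 t) :=
    hv.continuous.comp (continuous_polarPoint_right 1)
  have hf2 : Continuous fun t : ℝ => 2 * v (polarPoint 1 t) ^ 2 := continuous_const.mul (hf.pow 2)
  have hE : ∫ z in disk, ‖∇ v z‖ ^ 2 = ∫ t in (-Real.pi)..Real.pi, A t :=
    (integral_disk_eq_polar ((continuous_gradient hv).norm.pow 2)).trans
      (intervalIntegral_comm hcg _ _ _ _)
  rw [hE, integral_disk_eq_polar (F := fun z => v z ^ 2) (hv.continuous.pow 2),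
    intervalIntegral_comm hcv]
  simp only [integral_bdry_eq, bdryPoint_eq_polarPoint]
  rw [← intervalIntegral.integral_const_mul, ← intervalIntegral.integral_const_mul,
    ← intervalIntegral.integral_add
      (hf2.intervalIntegrable _ _)
      ((by fun_prop : Continuous fun t => 2 * A t).intervalIntegrable _ _)]
  refine intervalIntegral.integral_mono_on hππ
    ((intervalIntegral.continuous_parametric_intervalIntegral_of_continuous'
      (f := fun t r => r * v (polarPoint r t) ^ 2) (hcv.comp continuous_swap) 0 1
        ).intervalIntegrable _ _)
    ((hf2.add (continuous_const.mul hA)).intervalIntegrable _ _)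
    fun t _ => ?_
  have hr : ∀ r ∈ Set.Icc (0 : ℝ) 1,
      r * v (polarPoint r t) ^ 2 ≤ 2 * v (polarPoint 1 t) ^ 2 + 2 * A t := by
    intro r hr
    have h1 : r * (v (polarPoint 1 t) - v (polarPoint r t)) ^ 2 ≤ A t :=
      radial_increment_sq_le hv hr.1 hr.2 t
    have h2 : r * v (polarPoint 1 t) ^ 2 ≤ v (polarPoint 1 t) ^ 2 :=
      mul_le_of_le_one_left (sq_nonneg _) hr.2
    nlinarith [mul_nonneg hr.1 (sq_nonneg (2 * v (polarPoint 1 t) - v (polarPoint r t)))]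
  have hint := intervalIntegral.integral_mono_on (μ := volume) zero_le_one
    ((hcv.comp (by fun_prop : Continuous fun r : ℝ => (r, t))).intervalIntegrable 0 1)
    (continuous_const.intervalIntegrable 0 1) hr
  simpa using hint

end Estimates

/-! ### The Sobolev space as a closed subspace of `L²(Ω) × L²(Ω; ℝ²) × L²(∂Ω)` -/

/-- Triples consisting of a function on `Ω`, a vector field on `Ω` and a function on `∂Ω`, with
the Hilbert space structure of the orthogonal sum of the three `L²` spaces. -/
abbrev Triple : Type := WithLp 2 (L2Disk × WithLp 2 (L2DiskVec × L2Bdry))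

/-- The triple with the given components. -/
noncomputable def mkTriple (u : L2Disk) (G : L2DiskVec) (f : L2Bdry) : Triple :=
  WithLp.toLp 2 (u, WithLp.toLp 2 (G, f))

namespace Triple

/-- The function on `Ω`. -/
noncomputable def fn : Triple →L[ℝ] L2Disk := WithLp.fstL 2 ℝ _ _

/-- The vector field on `Ω`. -/
noncomputable def grad : Triple →L[ℝ] L2DiskVec := (WithLp.fstL 2 ℝ _ _).comp (WithLp.sndL 2 ℝ _ _)

/-- The function on `∂Ω`. -/
noncomputable def tr : Triple →L[ℝ] L2Bdry := (WithLp.sndL 2 ℝ _ _).comp (WithLp.sndL 2 ℝ _ _)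

@[simp] theorem fn_mkTriple (u : L2Disk) (G : L2DiskVec) (f : L2Bdry) :
    fn (mkTriple u G f) = u := rfl

@[simp] theorem grad_mkTriple (u : L2Disk) (G : L2DiskVec) (f : L2Bdry) :
    grad (mkTriple u G f) = G := rfl

@[simp] theorem tr_mkTriple (u : L2Disk) (G : L2DiskVec) (f : L2Bdry) :
    tr (mkTriple u G f) = f := rfl

theorem mkTriple_eta (x : Triple) : mkTriple (fn x) (grad x) (tr x) = x := rfl

theorem norm_sq_eq (x : Triple) : ‖x‖ ^ 2 = ‖fn x‖ ^ 2 + (‖grad x‖ ^ 2 + ‖tr x‖ ^ 2) := by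
  rw [WithLp.prod_norm_sq_eq_of_L2, WithLp.prod_norm_sq_eq_of_L2]
  rfl

theorem tendsto_iff {ι : Type*} {l : Filter ι} (x : ι → Triple) (y : Triple) :
    Tendsto x l (𝓝 y) ↔ Tendsto (fun i => fn (x i)) l (𝓝 (fn y)) ∧
      Tendsto (fun i => grad (x i)) l (𝓝 (grad y)) ∧
      Tendsto (fun i => tr (x i)) l (𝓝 (tr y)) := by
  refine ⟨fun h => ⟨(fn.continuous.tendsto y).comp h, (grad.continuous.tendsto y).comp h,
    (tr.continuous.tendsto y).comp h⟩, fun ⟨h1, h2, h3⟩ => ?_⟩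
  have h4 := ((WithLp.prod_continuous_toLp 2 L2DiskVec L2Bdry).tendsto _).comp (h2.prodMk_nhds h3)
  exact ((WithLp.prod_continuous_toLp 2 L2Disk (WithLp 2 (L2DiskVec × L2Bdry))).tendsto _).comp
    (h1.prodMk_nhds h4)

end Triple

open Triple

theorem continuous_bdryPoint : Continuous bdryPoint :=
  continuous_subtype_val.comp AddCircle.continuous_toCircle

instance isFiniteMeasure_diskMeasure : IsFiniteMeasure diskMeasure :=
  ⟨by rw [Measure.restrict_apply_univ]; exact measure_ball_lt_top⟩

theorem memLp_disk {E : Type*} [NormedAddCommGroup E] [SecondCountableTopology E] {F : ℂ → E}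
    (hF : Continuous F) : MemLp F 2 diskMeasure := by
  obtain ⟨C, hC⟩ := (isCompact_closedBall (0 : ℂ) 1).exists_bound_of_continuousOn hF.continuousOn
  refine MemLp.of_bound hF.aestronglyMeasurable C ?_
  filter_upwards [ae_restrict_mem measurableSet_disk] with z hz
  exact hC z (Metric.ball_subset_closedBall hz)

theorem memLp_bdry {v : ℂ → ℝ} (hv : Continuous v) :
    MemLp (fun θ => v (bdryPoint θ)) 2 (volume : Measure Bdry) :=
  (hv.comp continuous_bdryPoint).memLp_of_hasCompactSupport (HasCompactSupport.of_compactSpace _)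

/-- The triple `(v|_Ω, ∇v|_Ω, v|_{∂Ω})` of a smooth function `v`. -/
noncomputable def smoothTriple (v : ℂ → ℝ) (hv : ContDiff ℝ ∞ v) : Triple :=
  mkTriple ((memLp_disk hv.continuous).toLp v) ((memLp_disk (continuous_gradient hv)).toLp (∇ v))
    ((memLp_bdry hv.continuous).toLp _)

theorem gradient_add {v w : ℂ → ℝ} (hv : ContDiff ℝ ∞ v) (hw : ContDiff ℝ ∞ w) :
    ∇ (v + w) = ∇ v + ∇ w := by
  ext1 z
  simp only [gradient, Pi.add_apply]
  rw [fderiv_add (hv.differentiable (by simp) z) (hw.differentiable (by simp) z), map_add]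

theorem gradient_const_smul {v : ℂ → ℝ} (c : ℝ) (hv : ContDiff ℝ ∞ v) :
    ∇ (c • v) = c • ∇ v := by
  ext1 z
  simp only [gradient, Pi.smul_apply]
  rw [fderiv_const_smul (hv.differentiable (by simp) z), map_smulₛₗ]
  simp

theorem smoothTriple_add {v w : ℂ → ℝ} (hv : ContDiff ℝ ∞ v) (hw : ContDiff ℝ ∞ w) :
    smoothTriple (v + w) (hv.add hw) = smoothTriple v hv + smoothTriple w hw := by
  have h : (memLp_disk (continuous_gradient (hv.add hw))).toLp (∇ (v + w)) =
      (memLp_disk (continuous_gradient hv)).toLp (∇ v) +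
        (memLp_disk (continuous_gradient hw)).toLp (∇ w) := by
    rw [← MemLp.toLp_add]
    exact MemLp.toLp_congr _ _ (by rw [gradient_add hv hw])
  unfold smoothTriple
  rw [h]
  rfl

theorem smoothTriple_smul {v : ℂ → ℝ} (c : ℝ) (hv : ContDiff ℝ ∞ v) :
    smoothTriple (c • v) (hv.const_smul c) = c • smoothTriple v hv := by
  have h : (memLp_disk (continuous_gradient (hv.const_smul c))).toLp (∇ (c • v)) =
      c • (memLp_disk (continuous_gradient hv)).toLp (∇ v) := by
    rw [← MemLp.toLp_const_smul]
    exact MemLp.toLp_congr _ _ (by rw [gradient_const_smul c hv])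
  unfold smoothTriple
  rw [h]
  rfl

/-- The triples of smooth functions. -/
noncomputable def smoothTriples : Submodule ℝ Triple where
  carrier := {x | ∃ v hv, smoothTriple v hv = x}
  zero_mem' := by
    refine ⟨(0 : ℝ) • fun _ => (0 : ℝ),
      (contDiff_const : ContDiff ℝ ∞ fun _ : ℂ => (0 : ℝ)).const_smul (0 : ℝ), ?_⟩
    rw [smoothTriple_smul (0 : ℝ) (contDiff_const : ContDiff ℝ ∞ fun _ : ℂ => (0 : ℝ)), zero_smul]
  add_mem' := by
    rintro _ _ ⟨v, hv, rfl⟩ ⟨w, hw, rfl⟩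
    exact ⟨_, hv.add hw, smoothTriple_add hv hw⟩
  smul_mem' := by
    rintro c _ ⟨v, hv, rfl⟩
    exact ⟨_, hv.const_smul c, smoothTriple_smul c hv⟩

/-- The Sobolev space `H¹(Ω)`, encoded by the triples (function, weak gradient, trace): the
closure of the triples of smooth functions. -/
noncomputable def sobolev : Submodule ℝ Triple := smoothTriples.topologicalClosure

theorem smoothTriple_mem_sobolev {v : ℂ → ℝ} (hv : ContDiff ℝ ∞ v) :
    smoothTriple v hv ∈ sobolev :=
  smoothTriples.le_topologicalClosure ⟨v, hv, rfl⟩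

/-- A closed condition that holds for the triples of smooth functions holds on `sobolev`. -/
theorem sobolev_induction {p : Triple → Prop} (hp : IsClosed {x | p x})
    (h : ∀ v hv, p (smoothTriple v hv)) {x : Triple} (hx : x ∈ sobolev) : p x := by
  have : (sobolev : Set Triple) ⊆ {x | p x} := by
    rw [sobolev, Submodule.topologicalClosure_coe]
    refine closure_minimal ?_ hp
    rintro _ ⟨v, hv, rfl⟩
    exact h v hv
  exact this hx

theorem tendsto_toLp_iff {α E : Type*} [MeasurableSpace α] {μ : Measure α} [NormedAddCommGroup E]
    {F : ℕ → α → E} (hF : ∀ k, MemLp (F k) 2 μ) (g : Lp E 2 μ) :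
    Tendsto (fun k => (hF k).toLp (F k)) atTop (𝓝 g) ↔
      Tendsto (fun k => eLpNorm (fun z => F k z - g z) 2 μ) atTop (𝓝 0) := by
  have h := Lp.tendsto_Lp_iff_tendsto_eLpNorm'' F hF g (Lp.memLp g) (fi := atTop)
  rw [Lp.toLp_coeFn] at h
  exact h

theorem hasTrace_iff (u : L2Disk) (G : L2DiskVec) (f : L2Bdry) :
    HasTrace u G f ↔ mkTriple u G f ∈ sobolev := by
  have key : ∀ (v : ℕ → ℂ → ℝ) (hv : ∀ k, ContDiff ℝ ∞ (v k)),
      Tendsto (fun k => smoothTriple (v k) (hv k)) atTop (𝓝 (mkTriple u G f)) ↔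
      (Tendsto (fun k => eLpNorm (fun z => v k z - u z) 2 diskMeasure) atTop (𝓝 0) ∧
      Tendsto (fun k => eLpNorm (fun z => ∇ (v k) z - G z) 2 diskMeasure) atTop (𝓝 0) ∧
      Tendsto (fun k => eLpNorm (fun θ => v k (bdryPoint θ) - f θ) 2 (volume : Measure Bdry))
        atTop (𝓝 0)) := by
    intro v hv
    rw [tendsto_iff]
    refine and_congr ?_ (and_congr ?_ ?_)
    · exact tendsto_toLp_iff (fun k => memLp_disk (hv k).continuous) u
    · exact tendsto_toLp_iff (fun k => memLp_disk (continuous_gradient (hv k))) G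
    · exact tendsto_toLp_iff (fun k => memLp_bdry (hv k).continuous) f
  have hmem : mkTriple u G f ∈ sobolev ↔ mkTriple u G f ∈ closure (smoothTriples : Set Triple) := by
    rw [sobolev, ← SetLike.mem_coe, Submodule.topologicalClosure_coe]
  rw [hmem, mem_closure_iff_seq_limit]
  constructor
  · rintro ⟨v, hv, h⟩
    exact ⟨fun k => smoothTriple (v k) (hv k), fun k => ⟨_, _, rfl⟩, (key v hv).2 h⟩
  · rintro ⟨x, hx, hlim⟩
    choose v hv hvx using hx
    refine ⟨v, hv, (key v hv).1 ?_⟩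
    simpa only [hvx] using hlim

/-! ### Weak gradients -/

theorem inner_real_eq_mul (a b : ℝ) : inner ℝ a b = a * b := by simp [mul_comm]

theorem integral_mul_fderiv_eq_neg {v φ : ℂ → ℝ} (hv : ContDiff ℝ ∞ v) (hφ : ContDiff ℝ ∞ φ)
    (hc : HasCompactSupport φ) (w : ℂ) :
    ∫ z, v z * fderiv ℝ φ z w = -∫ z, fderiv ℝ v z w * φ z := by
  have hcd : ∀ {k : ℂ → ℝ}, ContDiff ℝ ∞ k → Continuous fun z => fderiv ℝ k z w := fun hk =>
    (hk.continuous_fderiv (by simp)).clm_apply continuous_const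
  refine integral_mul_fderiv_eq_neg_fderiv_mul_of_integrable ?_ ?_ ?_
    (fun z _ => hv.differentiable (by simp) z) fun z _ => hφ.differentiable (by simp) z
  · exact ((hcd hv).mul hφ.continuous).integrable_of_hasCompactSupport hc.mul_left
  · exact (hv.continuous.mul (hcd hφ)).integrable_of_hasCompactSupport
      ((hc.fderiv_apply ℝ w).mul_left)
  · exact (hv.continuous.mul hφ.continuous).integrable_of_hasCompactSupport hc.mul_left

/-- Integration by parts for smooth functions, extended to `sobolev` by closure. In particular
the condition `IsWeakGradient` is implied by `HasTrace`. -/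
theorem isWeakGradient_of_mem_sobolev {x : Triple} (hx : x ∈ sobolev) :
    IsWeakGradient (fn x) (grad x) := by
  intro φ hφ hc hsupp
  have hφ2 : MemLp φ 2 diskMeasure := memLp_disk hφ.continuous
  have hdφ : ∀ w, MemLp (fun z => fderiv ℝ φ z w) 2 diskMeasure := fun w =>
    memLp_disk ((hφ.continuous_fderiv (by simp)).clm_apply continuous_const)
  have hφw : ∀ w : ℂ, MemLp (fun z => φ z • w) 2 diskMeasure := fun w =>
    memLp_disk (hφ.continuous.smul continuous_const)
  -- the identity tested with a vector `w`, as an identity of `L²` inner products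
  have hclosed : ∀ w : ℂ, inner ℝ (fn x) ((hdφ w).toLp _) =
      - inner ℝ (grad x) ((hφw w).toLp _) := by
    intro w
    refine sobolev_induction (p := fun x => inner ℝ (fn x) ((hdφ w).toLp _) =
      - inner ℝ (grad x) ((hφw w).toLp _)) ?_ ?_ hx
    · exact isClosed_eq (fn.continuous.inner continuous_const)
        (grad.continuous.inner continuous_const).neg
    · intro v hv
      simp only [L2.inner_def, smoothTriple, fn_mkTriple, grad_mkTriple]
      have e1 : ∫ z in disk, inner ℝ ((memLp_disk hv.continuous).toLp v z) ((hdφ w).toLp _ z) =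
          ∫ z in disk, v z * fderiv ℝ φ z w := by
        refine integral_congr_ae ?_
        filter_upwards [(memLp_disk hv.continuous).coeFn_toLp, (hdφ w).coeFn_toLp] with z h1 h2
        rw [h1, h2, inner_real_eq_mul]
      have e2 : ∫ z in disk, inner ℝ ((memLp_disk (continuous_gradient hv)).toLp (∇ v) z)
          ((hφw w).toLp _ z) = ∫ z in disk, fderiv ℝ v z w * φ z := by
        refine integral_congr_ae ?_
        filter_upwards [(memLp_disk (continuous_gradient hv)).coeFn_toLp,
          (hφw w).coeFn_toLp] with z h1 h2
        rw [h1, h2, inner_smul_right, inner_gradient_left, mul_comm]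
      have hzero : ∀ z, z ∉ disk → φ z = 0 := fun z hz =>
        image_eq_zero_of_notMem_tsupport fun h => hz (hsupp h)
      have hdzero : ∀ z, z ∉ disk → fderiv ℝ φ z = 0 := fun z hz =>
        image_eq_zero_of_notMem_tsupport fun h => hz (hsupp (tsupport_fderiv_subset ℝ h))
      rw [e1, e2, setIntegral_eq_integral_of_forall_compl_eq_zero fun z hz => by simp [hdzero z hz],
        setIntegral_eq_integral_of_forall_compl_eq_zero fun z hz => by simp [hzero z hz]]
      exact integral_mul_fderiv_eq_neg hv hφ hc w
  have hi1 : Integrable (fun z => fn x z • ∇ φ z) diskMeasure :=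
    memLp_one_iff_integrable.1 ((memLp_disk (continuous_gradient hφ)).smul (Lp.memLp (fn x)))
  have hi2 : Integrable (fun z => φ z • grad x z) diskMeasure :=
    memLp_one_iff_integrable.1 ((Lp.memLp (grad x)).smul hφ2)
  refine ext_inner_left ℝ fun w => ?_
  rw [inner_neg_right, ← integral_inner hi1, ← integral_inner hi2]
  have h := hclosed w
  rw [L2.inner_def, L2.inner_def] at h
  refine Eq.trans (integral_congr_ae ?_) (h.trans (congrArg Neg.neg (integral_congr_ae ?_)))
  · filter_upwards [(hdφ w).coeFn_toLp] with z hz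
    rw [hz, inner_smul_right, real_inner_comm, inner_gradient_left, inner_real_eq_mul]
  · filter_upwards [(hφw w).coeFn_toLp] with z hz
    rw [hz, inner_smul_right, inner_smul_right, real_inner_comm]

/-! ### A priori estimates on the Sobolev space -/

theorem norm_sq_toLp {α E : Type*} [MeasurableSpace α] {μ : Measure α} [NormedAddCommGroup E]
    [InnerProductSpace ℝ E] {F : α → E} (hF : MemLp F 2 μ) :
    ‖hF.toLp F‖ ^ 2 = ∫ z, ‖F z‖ ^ 2 ∂μ := by
  rw [← real_inner_self_eq_norm_sq, L2.inner_def]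
  refine integral_congr_ae ?_
  filter_upwards [hF.coeFn_toLp] with z hz
  rw [hz, real_inner_self_eq_norm_sq]

/-- The triple of the constant function `1`. -/
noncomputable def oneTriple : Triple := smoothTriple (fun _ => 1) contDiff_const

theorem oneTriple_mem_sobolev : oneTriple ∈ sobolev := smoothTriple_mem_sobolev _

theorem grad_oneTriple : grad oneTriple = 0 := by
  have h : (∇ fun _ : ℂ => (1 : ℝ)) = 0 := by
    ext1 z; exact gradient_fun_const z 1
  exact (MemLp.toLp_congr (memLp_disk (continuous_gradient contDiff_const)) MemLp.zero
    (by rw [h])).trans (MemLp.toLp_zero _)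

theorem inner_tr_oneTriple (f : L2Bdry) : inner ℝ (tr oneTriple) f = ∫ θ, f θ := by
  rw [L2.inner_def]
  refine integral_congr_ae ?_
  have h : (tr oneTriple : Bdry → ℝ) =ᵐ[volume] fun _ => 1 :=
    MemLp.coeFn_toLp (memLp_bdry (v := fun _ => 1) continuous_const)
  filter_upwards [h] with θ hθ
  rw [hθ, inner_real_eq_mul, one_mul]

theorem norm_sq_tr_le {x : Triple} (hx : x ∈ sobolev) :
    ‖tr x‖ ^ 2 ≤ (4 + 16 * Real.pi ^ 2) * ‖grad x‖ ^ 2 + (∫ θ, tr x θ) ^ 2 := by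
  simp only [← inner_tr_oneTriple]
  refine sobolev_induction (p := fun x => ‖tr x‖ ^ 2 ≤ (4 + 16 * Real.pi ^ 2) * ‖grad x‖ ^ 2 +
    (inner ℝ (tr oneTriple) (tr x)) ^ 2) ?_ ?_ hx
  · exact isClosed_le (by fun_prop) (by fun_prop)
  · intro v hv
    rw [inner_tr_oneTriple]
    simp only [smoothTriple, tr_mkTriple, grad_mkTriple, norm_sq_toLp]
    rw [integral_congr_ae (memLp_bdry hv.continuous).coeFn_toLp]
    simpa only [Real.norm_eq_abs, sq_abs] using integral_sq_trace_le hv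

theorem norm_sq_fn_le {x : Triple} (hx : x ∈ sobolev) :
    ‖fn x‖ ^ 2 ≤ 2 * ‖tr x‖ ^ 2 + 2 * ‖grad x‖ ^ 2 := by
  refine sobolev_induction (p := fun x => ‖fn x‖ ^ 2 ≤ 2 * ‖tr x‖ ^ 2 + 2 * ‖grad x‖ ^ 2) ?_ ?_ hx
  · exact isClosed_le (by fun_prop) (by fun_prop)
  · intro v hv
    simp only [smoothTriple, tr_mkTriple, grad_mkTriple, fn_mkTriple, norm_sq_toLp]
    simpa only [Real.norm_eq_abs, sq_abs] using integral_sq_disk_le hv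

/-- The triples in `sobolev` with mean free trace. -/
noncomputable def sobolevDiamond : Submodule ℝ Triple :=
  sobolev ⊓ LinearMap.ker ((innerSL ℝ (tr oneTriple)).comp tr).toLinearMap

theorem mem_sobolevDiamond {x : Triple} :
    x ∈ sobolevDiamond ↔ x ∈ sobolev ∧ ∫ θ, tr x θ = 0 := by
  rw [← inner_tr_oneTriple]
  rfl

instance completeSpace_sobolevDiamond : CompleteSpace sobolevDiamond := by
  refine IsClosed.completeSpace_coe (hs := ?_)
  exact (Submodule.isClosed_topologicalClosure _).inter
    (ContinuousLinearMap.isClosed_ker ((innerSL ℝ (tr oneTriple)).comp tr))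

theorem norm_sq_le_of_mem_sobolevDiamond {x : Triple} (hx : x ∈ sobolevDiamond) :
    ‖x‖ ^ 2 ≤ (15 + 48 * Real.pi ^ 2) * ‖grad x‖ ^ 2 := by
  obtain ⟨hx1, hx2⟩ := mem_sobolevDiamond.1 hx
  have h1 := norm_sq_tr_le hx1
  have h2 := norm_sq_fn_le hx1
  rw [hx2] at h1
  rw [norm_sq_eq]
  linarith

/-! ### The energy form and well-posedness of the Neumann problem -/

/-- The form `∫_Ω σ ∇u·∇v` on triples. -/
noncomputable def energy (σ : ℂ → ℝ) (x y : Triple) : ℝ :=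
  ∫ z in disk, σ z * inner ℝ (grad x z) (grad y z)

/-- Multiplication of vector fields by a bounded function. -/
noncomputable def mulVec {σ : ℂ → ℝ} (hσ : MemLp σ ∞ diskMeasure) : L2DiskVec →L[ℝ] L2DiskVec :=
  (ContinuousLinearMap.lsmul ℝ ℝ : ℝ →L[ℝ] ℂ →L[ℝ] ℂ).holderL diskMeasure ∞ 2 2 (hσ.toLp σ)

theorem coeFn_mulVec {σ : ℂ → ℝ} (hσ : MemLp σ ∞ diskMeasure) (G : L2DiskVec) :
    mulVec hσ G =ᵐ[diskMeasure] fun z => σ z • G z := by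
  have h := (ContinuousLinearMap.lsmul ℝ ℝ : ℝ →L[ℝ] ℂ →L[ℝ] ℂ).coeFn_holder (r := 2)
    (hσ.toLp σ) G
  filter_upwards [h, hσ.coeFn_toLp] with z h1 h2
  change ((ContinuousLinearMap.lsmul ℝ ℝ : ℝ →L[ℝ] ℂ →L[ℝ] ℂ).holder 2 (hσ.toLp σ) G) z = _
  rw [h1, h2]
  rfl

theorem energy_eq_inner {σ : ℂ → ℝ} (hσ : MemLp σ ∞ diskMeasure) (x y : Triple) :
    energy σ x y = inner ℝ (mulVec hσ (grad x)) (grad y) := by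
  rw [L2.inner_def, energy]
  refine integral_congr_ae ?_
  filter_upwards [coeFn_mulVec hσ (grad x)] with z hz
  rw [hz, real_inner_smul_left]

theorem energy_comm (σ : ℂ → ℝ) (x y : Triple) : energy σ x y = energy σ y x := by
  refine integral_congr_ae (.of_forall fun z => ?_)
  simp only [real_inner_comm (grad x z)]

theorem le_energy_self {σ : ℂ → ℝ} (hσ : MemLp σ ∞ diskMeasure) {c : ℝ}
    (hc : ∀ᵐ z ∂diskMeasure, c ≤ σ z) (x : Triple) : c * ‖grad x‖ ^ 2 ≤ energy σ x x := by
  have hi : Integrable (fun z => inner ℝ (mulVec hσ (grad x) z) (grad x z)) diskMeasure :=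
    L2.integrable_inner _ _
  rw [energy_eq_inner hσ, ← real_inner_self_eq_norm_sq, L2.inner_def, L2.inner_def,
    ← integral_const_mul]
  refine integral_mono_ae ((L2.integrable_inner _ _).const_mul c) hi ?_
  filter_upwards [hc, coeFn_mulVec hσ (grad x)] with z h1 h2
  rw [h2, real_inner_smul_left, real_inner_self_eq_norm_sq]
  exact mul_le_mul_of_nonneg_right h1 (sq_nonneg _)

/-- The triple `x` is the weak solution of the Neumann problem with current `ψ`. -/
structure IsSolution (σ : ℂ → ℝ) (ψ : L2Bdry) (x : Triple) : Prop where
  mem : x ∈ sobolevDiamond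
  weakForm : ∀ y ∈ sobolev, energy σ x y = inner ℝ ψ (tr y)

theorem isNDValue_iff {σ : ℂ → ℝ} {ψ f : L2Diamond} :
    IsNDValue σ ψ f ↔ ∃ x, IsSolution σ ψ x ∧ tr x = f := by
  have hinner : ∀ h : L2Bdry, inner ℝ (ψ : L2Bdry) h = ∫ θ, (ψ : L2Bdry) θ * h θ := fun h => by
    rw [L2.inner_def]
    simp only [inner_real_eq_mul]
  constructor
  · rintro ⟨u, G, h⟩
    refine ⟨mkTriple u G f, ⟨mem_sobolevDiamond.2 ⟨(hasTrace_iff _ _ _).1 h.trace, h.meanFree⟩,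
      fun y hy => ?_⟩, rfl⟩
    rw [hinner]
    exact h.weakForm (fn y) (grad y) (tr y) (isWeakGradient_of_mem_sobolev hy)
      ((hasTrace_iff _ _ _).2 hy)
  · rintro ⟨x, h, hx⟩
    have hmem := (mem_sobolevDiamond.1 h.mem).1
    refine ⟨fn x, grad x, isWeakGradient_of_mem_sobolev hmem, ?_, fun v H k _ hk => ?_, f.2⟩
    · rw [← hx]
      exact (hasTrace_iff _ _ _).2 hmem
    · rw [← hinner]
      exact h.weakForm (mkTriple v H k) ((hasTrace_iff _ _ _).1 hk)

/-- The Lax-Milgram theorem in the form of the solvability of a variational equation. -/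
theorem exists_of_isCoercive {V : Type*} [NormedAddCommGroup V] [InnerProductSpace ℝ V]
    [CompleteSpace V] {B : V →L[ℝ] V →L[ℝ] ℝ} (hB : IsCoercive B) (ℓ : V →L[ℝ] ℝ) :
    ∃ x, ∀ y, B x y = ℓ y := by
  refine ⟨hB.continuousLinearEquivOfBilin.symm ((InnerProductSpace.toDual ℝ V).symm ℓ),
    fun y => ?_⟩
  rw [← hB.continuousLinearEquivOfBilin_apply, ContinuousLinearEquiv.apply_symm_apply,
    InnerProductSpace.toDual_symm_apply]

theorem exists_isSolution {σ : ℂ → ℝ} (hσ : IsConductivity σ) (ψ : L2Diamond) :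
    ∃ x, IsSolution σ ψ x := by
  obtain ⟨c, hc, hcσ⟩ := hσ.strictlyPos
  obtain ⟨B, hB⟩ : ∃ B : sobolevDiamond →L[ℝ] sobolevDiamond →L[ℝ] ℝ,
      ∀ x y : sobolevDiamond, B x y = energy σ x y :=
    ⟨(innerSL ℝ).bilinearComp ((mulVec hσ.memLp).comp (grad.comp sobolevDiamond.subtypeL))
      (grad.comp sobolevDiamond.subtypeL), fun x y => (energy_eq_inner hσ.memLp _ _).symm⟩
  have hK : 0 < 15 + 48 * Real.pi ^ 2 := by positivity
  have hcoer : IsCoercive B := by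
    refine ⟨c / (15 + 48 * Real.pi ^ 2), by positivity, fun x => ?_⟩
    have h1 := norm_sq_le_of_mem_sobolevDiamond x.2
    have h2 := le_energy_self hσ.memLp hcσ x
    rw [hB, mul_assoc, ← sq, div_mul_eq_mul_div, div_le_iff₀ hK]
    calc c * ‖x‖ ^ 2 ≤ c * ((15 + 48 * Real.pi ^ 2) * ‖grad x‖ ^ 2) :=
          mul_le_mul_of_nonneg_left h1 hc.le
      _ = (c * ‖grad x‖ ^ 2) * (15 + 48 * Real.pi ^ 2) := by ring
      _ ≤ _ := mul_le_mul_of_nonneg_right h2 hK.le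
  obtain ⟨ℓ, hℓ⟩ : ∃ ℓ : sobolevDiamond →L[ℝ] ℝ,
      ∀ y : sobolevDiamond, ℓ y = inner ℝ (ψ : L2Bdry) (tr y) :=
    ⟨(innerSL ℝ (ψ : L2Bdry)).comp (tr.comp sobolevDiamond.subtypeL), fun _ => rfl⟩
  obtain ⟨x, hx⟩ := exists_of_isCoercive (V := sobolevDiamond) (B := B) hcoer ℓ
  replace hx : ∀ y : sobolevDiamond, energy σ x y = inner ℝ (ψ : L2Bdry) (tr y) :=
    fun y => (hB x y).symm.trans ((hx y).trans (hℓ y))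
  refine ⟨x, x.2, fun y hy => ?_⟩
  -- subtract from `y` the mean value of its trace; neither side changes
  have hone : ∫ θ, tr oneTriple θ = 2 * Real.pi := by
    have h : (tr oneTriple : Bdry → ℝ) =ᵐ[volume] fun _ => 1 :=
      MemLp.coeFn_toLp (memLp_bdry (v := fun _ => 1) continuous_const)
    rw [integral_congr_ae h, integral_bdry_eq, intervalIntegral.integral_const, smul_eq_mul]
    ring
  set m : ℝ := (∫ θ, tr y θ) / (2 * Real.pi)
  have hmem : y - m • oneTriple ∈ sobolevDiamond := by
    refine mem_sobolevDiamond.2 ⟨sobolev.sub_mem hy (sobolev.smul_mem _ oneTriple_mem_sobolev), ?_⟩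
    rw [← inner_tr_oneTriple, map_sub, map_smul, inner_sub_right, inner_smul_right,
      inner_tr_oneTriple, inner_tr_oneTriple, hone, sub_eq_zero]
    have := Real.pi_pos
    simp only [m]
    field_simp
  have h := hx ⟨_, hmem⟩
  have hψ : inner ℝ (ψ : L2Bdry) (tr oneTriple) = 0 := by
    rw [real_inner_comm, inner_tr_oneTriple]
    exact ψ.2
  rw [energy_eq_inner hσ.memLp] at h ⊢
  simpa [grad_oneTriple, inner_sub_right, inner_smul_right, hψ] using h

theorem IsSolution.tr_unique {σ : ℂ → ℝ} (hσ : IsConductivity σ) {ψ : L2Bdry} {x y : Triple}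
    (hx : IsSolution σ ψ x) (hy : IsSolution σ ψ y) : tr x = tr y := by
  obtain ⟨c, hc, hcσ⟩ := hσ.strictlyPos
  have hd : x - y ∈ sobolevDiamond := sobolevDiamond.sub_mem hx.mem hy.mem
  have hd1 := (mem_sobolevDiamond.1 hd).1
  have h0 : energy σ (x - y) (x - y) = 0 := by
    have h1 := hx.weakForm _ hd1
    have h2 := hy.weakForm _ hd1
    rw [energy_eq_inner hσ.memLp] at h1 h2 ⊢
    rw [map_sub grad x y, map_sub (mulVec hσ.memLp), inner_sub_left, ← map_sub, h1, h2, sub_self]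
  have h1 := le_energy_self hσ.memLp hcσ (x - y)
  have h2 := norm_sq_le_of_mem_sobolevDiamond hd
  have h3 : ‖grad (x - y)‖ ^ 2 ≤ 0 := by
    by_contra! h
    have := mul_pos hc h
    linarith
  have h4 : ‖x - y‖ ^ 2 ≤ 0 :=
    h2.trans (mul_nonpos_of_nonneg_of_nonpos (by positivity) h3)
  have h5 : x - y = 0 := by
    rw [← norm_eq_zero]
    exact pow_eq_zero_iff two_ne_zero |>.1 (le_antisymm h4 (sq_nonneg _))
  rw [sub_eq_zero.1 h5]

theorem ndWellDefined {σ : ℂ → ℝ} (hσ : IsConductivity σ) : NDWellDefined σ := by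
  intro ψ
  obtain ⟨x, hx⟩ := exists_isSolution hσ ψ
  refine ⟨⟨tr x, (mem_sobolevDiamond.1 hx.mem).2⟩, isNDValue_iff.2 ⟨x, hx, rfl⟩, fun f hf => ?_⟩
  obtain ⟨y, hy, hyf⟩ := isNDValue_iff.1 hf
  exact Subtype.ext (hyf.symm.trans (hy.tr_unique hσ hx))

/-! ### The Neumann-to-Dirichlet map is linear and symmetric -/

theorem isNDValue_NDMap {σ : ℂ → ℝ} (hσ : IsConductivity σ) (ψ : L2Diamond) :
    IsNDValue σ ψ (NDMap σ ψ) := by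
  have h := (ndWellDefined hσ ψ).exists
  rw [NDMap, dif_pos h]
  exact h.choose_spec

theorem IsNDValue.NDMap_eq {σ : ℂ → ℝ} (hσ : IsConductivity σ) {ψ f : L2Diamond}
    (h : IsNDValue σ ψ f) : NDMap σ ψ = f :=
  (ndWellDefined hσ ψ).unique (isNDValue_NDMap hσ ψ) h

theorem NDMap_linear_comb {σ : ℂ → ℝ} (hσ : IsConductivity σ) (a b : ℝ) (ψ φ : L2Diamond) :
    NDMap σ (a • ψ + b • φ) = a • NDMap σ ψ + b • NDMap σ φ := by
  obtain ⟨x, hx, hxf⟩ := isNDValue_iff.1 (isNDValue_NDMap hσ ψ)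
  obtain ⟨y, hy, hyf⟩ := isNDValue_iff.1 (isNDValue_NDMap hσ φ)
  refine IsNDValue.NDMap_eq hσ (isNDValue_iff.2 ⟨a • x + b • y, ⟨?_, fun w hw => ?_⟩, ?_⟩)
  · exact sobolevDiamond.add_mem (sobolevDiamond.smul_mem a hx.mem)
      (sobolevDiamond.smul_mem b hy.mem)
  · have h1 := hx.weakForm w hw
    have h2 := hy.weakForm w hw
    rw [energy_eq_inner hσ.memLp] at h1 h2 ⊢
    simp only [map_add, map_smul, inner_add_left, real_inner_smul_left, h1, h2, Submodule.coe_add,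
      Submodule.coe_smul]
  · simp only [map_add, map_smul, hxf, hyf, Submodule.coe_add, Submodule.coe_smul]

theorem inner_NDMap_comm {σ : ℂ → ℝ} (hσ : IsConductivity σ) (ψ φ : L2Diamond) :
    inner ℝ (NDMap σ ψ : L2Bdry) (φ : L2Bdry) = inner ℝ (ψ : L2Bdry) (NDMap σ φ : L2Bdry) := by
  obtain ⟨x, hx, hxf⟩ := isNDValue_iff.1 (isNDValue_NDMap hσ ψ)
  obtain ⟨y, hy, hyf⟩ := isNDValue_iff.1 (isNDValue_NDMap hσ φ)
  rw [← hxf, ← hyf, ← hx.weakForm y (mem_sobolevDiamond.1 hy.mem).1, real_inner_comm,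
    ← hy.weakForm x (mem_sobolevDiamond.1 hx.mem).1, energy_comm]

/-! ### Equivariance under the orthogonal group -/

/-- An orthogonal map of the plane together with its action on the circle in the angle
coordinate. -/
structure DiskSymmetry where
  /-- The action on the plane. -/
  plane : ℂ ≃ₗᵢ[ℝ] ℂ
  /-- The action on the circle. -/
  circle : Bdry ≃ᵐ Bdry
  measurePreserving_circle : MeasurePreserving circle volume volume
  bdryPoint_circle : ∀ θ, bdryPoint (circle θ) = plane (bdryPoint θ)

namespace DiskSymmetry

/-- The inverse symmetry. -/
noncomputable def symm (s : DiskSymmetry) : DiskSymmetry where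
  plane := s.plane.symm
  circle := s.circle.symm
  measurePreserving_circle := s.measurePreserving_circle.symm
  bdryPoint_circle θ := by
    rw [LinearIsometryEquiv.eq_symm_apply, ← s.bdryPoint_circle, MeasurableEquiv.apply_symm_apply]

/-- The rotation by the angle `a`. -/
noncomputable def rotation (a : Bdry) : DiskSymmetry where
  plane := _root_.rotation (AddCircle.toCircle a)
  circle := MeasurableEquiv.addRight a
  measurePreserving_circle := measurePreserving_add_right volume a
  bdryPoint_circle θ := by
    change bdryPoint (θ + a) = _
    rw [bdryPoint, AddCircle.toCircle_add, rotation_apply, Circle.coe_mul, mul_comm]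
    rfl

/-- The reflection at the real axis. -/
noncomputable def reflection : DiskSymmetry where
  plane := Complex.conjLIE
  circle := MeasurableEquiv.neg Bdry
  measurePreserving_circle := Measure.measurePreserving_neg volume
  bdryPoint_circle θ := by
    change bdryPoint (-θ) = _
    rw [bdryPoint, AddCircle.toCircle_neg, Circle.coe_inv_eq_conj]
    rfl

variable (s : DiskSymmetry)

theorem measurePreserving_plane : MeasurePreserving s.plane diskMeasure diskMeasure := by
  have h := s.plane.measurePreserving.restrict_preimage measurableSet_disk
  have hpre : s.plane ⁻¹' disk = disk := by
    ext z
    simp [disk]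
  rwa [hpre] at h

/-- The action on triples by composition; gradients are moreover rotated back. -/
noncomputable def pull (x : Triple) : Triple :=
  mkTriple (Lp.compMeasurePreserving s.plane s.measurePreserving_plane (fn x))
    ((s.plane.symm.toContinuousLinearEquiv : ℂ →L[ℝ] ℂ).compLp
      (Lp.compMeasurePreserving s.plane s.measurePreserving_plane (grad x)))
    (Lp.compMeasurePreserving s.circle s.measurePreserving_circle (tr x))

theorem grad_pull (x : Triple) :
    grad (s.pull x) =ᵐ[diskMeasure] fun z => s.plane.symm (grad x (s.plane z)) := by
  have h := ContinuousLinearMap.coeFn_compLp (s.plane.symm.toContinuousLinearEquiv : ℂ →L[ℝ] ℂ)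
    (Lp.compMeasurePreserving s.plane s.measurePreserving_plane (grad x))
  have h' := Lp.coeFn_compMeasurePreserving (grad x) s.measurePreserving_plane
  filter_upwards [h, h'] with z h1 h2
  rw [Function.comp_apply] at h2
  rw [← h2]
  exact h1

theorem tr_pull (x : Triple) : tr (s.pull x) =ᵐ[volume] fun θ => tr x (s.circle θ) :=
  Lp.coeFn_compMeasurePreserving (tr x) s.measurePreserving_circle

theorem continuous_pull : Continuous s.pull := by
  rw [continuous_iff_continuousAt]
  intro x
  refine (tendsto_iff _ _).2 ⟨?_, ?_, ?_⟩
  · exact ((Lp.isometry_compMeasurePreserving s.measurePreserving_plane).continuous.comp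
      fn.continuous).tendsto x
  · exact (((ContinuousLinearMap.compLpL 2 diskMeasure
      (s.plane.symm.toContinuousLinearEquiv : ℂ →L[ℝ] ℂ)).continuous.comp
      (Lp.isometry_compMeasurePreserving s.measurePreserving_plane).continuous).comp
      grad.continuous).tendsto x
  · exact ((Lp.isometry_compMeasurePreserving s.measurePreserving_circle).continuous.comp
      tr.continuous).tendsto x

theorem gradient_comp {v : ℂ → ℝ} (hv : ContDiff ℝ ∞ v) (z : ℂ) :
    ∇ (v ∘ s.plane) z = s.plane.symm (∇ v (s.plane z)) := by
  refine ext_inner_right ℝ fun w => ?_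
  rw [inner_gradient_left, ← s.plane.inner_map_map, LinearIsometryEquiv.apply_symm_apply,
    inner_gradient_left]
  have h : HasFDerivAt s.plane (s.plane.toContinuousLinearEquiv : ℂ →L[ℝ] ℂ) z :=
    s.plane.toContinuousLinearEquiv.hasFDerivAt
  rw [((hv.differentiable (by simp) _).hasFDerivAt.comp z h).fderiv]
  rfl

theorem pull_smoothTriple {v : ℂ → ℝ} (hv : ContDiff ℝ ∞ v) :
    s.pull (smoothTriple v hv) = smoothTriple (v ∘ s.plane)
      (hv.comp s.plane.toContinuousLinearEquiv.contDiff) := by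
  have hcomp : ContDiff ℝ ∞ (v ∘ s.plane) := hv.comp s.plane.toContinuousLinearEquiv.contDiff
  have h1 : fn (s.pull (smoothTriple v hv)) = (memLp_disk hcomp.continuous).toLp _ :=
    (Lp.toLp_compMeasurePreserving (memLp_disk hv.continuous) s.measurePreserving_plane)
  have h2 : grad (s.pull (smoothTriple v hv)) =
      (memLp_disk (continuous_gradient hcomp)).toLp (∇ (v ∘ s.plane)) := by
    refine Lp.ext ?_
    have h := s.measurePreserving_plane.quasiMeasurePreserving.ae
      (memLp_disk (continuous_gradient hv)).coeFn_toLp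
    filter_upwards [s.grad_pull (smoothTriple v hv), h,
      (memLp_disk (continuous_gradient hcomp)).coeFn_toLp] with z e1 e2 e3
    rw [e1, e3, s.gradient_comp hv, ← e2]
    rfl
  have h3 : tr (s.pull (smoothTriple v hv)) = (memLp_bdry hcomp.continuous).toLp _ := by
    refine (Lp.toLp_compMeasurePreserving (memLp_bdry hv.continuous)
      s.measurePreserving_circle).trans (MemLp.toLp_congr _ _ (.of_forall fun θ => ?_))
    simp only [Function.comp_apply, s.bdryPoint_circle]
  rw [← mkTriple_eta (s.pull _), h1, h2, h3]
  rfl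

theorem pull_mem_sobolev {x : Triple} (hx : x ∈ sobolev) : s.pull x ∈ sobolev := by
  refine sobolev_induction (p := fun x => s.pull x ∈ sobolev) ?_ (fun v hv => ?_) hx
  · exact (Submodule.isClosed_topologicalClosure smoothTriples).preimage s.continuous_pull
  · rw [s.pull_smoothTriple]
    exact smoothTriple_mem_sobolev _

theorem energy_pull {σ : ℂ → ℝ} (hrot : IsRotSymmetric σ) (x y : Triple) :
    energy σ (s.pull x) y = energy σ x (s.symm.pull y) := by
  obtain ⟨ρ, hρ⟩ := hrot
  have hmp := s.measurePreserving_plane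
  have hρ' := hmp.quasiMeasurePreserving.ae hρ
  have hG := hmp.quasiMeasurePreserving.ae (s.symm.grad_pull y)
  unfold energy
  rw [← hmp.integral_comp s.plane.toHomeomorph.measurableEmbedding
    fun z => σ z * inner ℝ (grad x z) (grad (s.symm.pull y) z)]
  refine integral_congr_ae ?_
  filter_upwards [s.grad_pull x, hρ, hρ', hG] with z h1 h2 h3 h4
  rw [h1, h2, h3, h4, LinearIsometryEquiv.norm_map]
  have h5 : s.symm.plane.symm = s.plane := rfl
  have h6 : s.symm.plane (s.plane z) = z := s.plane.symm_apply_apply z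
  rw [h5, h6, ← s.plane.inner_map_map (s.plane.symm _), LinearIsometryEquiv.apply_symm_apply]

/-- The Neumann-to-Dirichlet map of a rotationally symmetric conductivity is equivariant. -/
theorem NDMap_comp {σ : ℂ → ℝ} (hσ : IsConductivity σ) (hrot : IsRotSymmetric σ)
    {ψ ψ' : L2Diamond} (hψ : (ψ' : L2Bdry) =ᵐ[volume] fun θ => (ψ : L2Bdry) (s.circle θ)) :
    (NDMap σ ψ' : L2Bdry) =ᵐ[volume] fun θ => (NDMap σ ψ : L2Bdry) (s.circle θ) := by
  obtain ⟨x, hx, hxf⟩ := isNDValue_iff.1 (isNDValue_NDMap hσ ψ)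
  have hmp := s.measurePreserving_circle
  have hint : ∀ F : Bdry → ℝ, ∫ θ, F (s.circle θ) = ∫ θ, F θ :=
    fun F => hmp.integral_comp s.circle.measurableEmbedding F
  have hmem := mem_sobolevDiamond.1 hx.mem
  have hmean : ∫ θ, tr (s.pull x) θ = 0 := by
    rw [integral_congr_ae (s.tr_pull x), hint]
    exact hmem.2
  have hsol : IsSolution σ ψ' (s.pull x) := by
    refine ⟨mem_sobolevDiamond.2 ⟨s.pull_mem_sobolev hmem.1, hmean⟩, fun y hy => ?_⟩
    rw [s.energy_pull hrot, hx.weakForm _ (s.symm.pull_mem_sobolev hy), L2.inner_def, L2.inner_def,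
      ← hint]
    refine integral_congr_ae ?_
    filter_upwards [hψ, hmp.quasiMeasurePreserving.ae (s.symm.tr_pull y)] with θ h1 h2
    have h3 : s.symm.circle (s.circle θ) = θ := s.circle.symm_apply_apply θ
    rw [h1, h2, h3]
  have h : NDMap σ ψ' = ⟨tr (s.pull x), hmean⟩ :=
    IsNDValue.NDMap_eq hσ (isNDValue_iff.2 ⟨_, hsol, rfl⟩)
  rw [h, ← hxf]
  exact s.tr_pull x

end DiskSymmetry

/-! ### The trigonometric functions are eigenfunctions -/

/-- The function `φ_n` as an element of `L²_⋄(∂Ω)`, for an arbitrary frequency `n ≠ 0`. -/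
noncomputable def trigDiamond (n : ℤ) (hn : n ≠ 0) : L2Diamond :=
  ⟨(memLp_trigFun n).toLp _, by
    rw [mem_L2Diamond, integral_congr_ae (memLp_trigFun n).coeFn_toLp]
    exact integral_trigFun hn⟩

theorem coeFn_trigDiamond {n : ℤ} (hn : n ≠ 0) :
    (trigDiamond n hn : L2Bdry) =ᵐ[volume] trigFun n := (memLp_trigFun n).coeFn_toLp

theorem trigFun_add {n : ℤ} (hn : 0 < n) (θ a : Bdry) :
    trigFun n (θ + a) =
      √Real.pi * (trigFun n a * trigFun n θ - trigFun (-n) a * trigFun (-n) θ) := by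
  induction θ using QuotientAddGroup.induction_on with | _ t
  induction a using QuotientAddGroup.induction_on with | _ b
  have hs : √Real.pi ≠ 0 := (Real.sqrt_pos.2 Real.pi_pos).ne'
  change trigReal n (t + b) = √Real.pi * (trigReal n b * trigReal n t -
    trigReal (-n) b * trigReal (-n) t)
  simp only [trigReal, hn.not_gt, neg_lt_zero.2 hn, if_true, if_false, mul_add, Real.cos_add,
    Int.cast_neg, neg_mul, Real.sin_neg]
  field_simp

theorem trigFun_neg_add {n : ℤ} (hn : 0 < n) (θ a : Bdry) :
    trigFun (-n) (θ + a) =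
      √Real.pi * (trigFun n a * trigFun (-n) θ + trigFun (-n) a * trigFun n θ) := by
  induction θ using QuotientAddGroup.induction_on with | _ t
  induction a using QuotientAddGroup.induction_on with | _ b
  have hs : √Real.pi ≠ 0 := (Real.sqrt_pos.2 Real.pi_pos).ne'
  change trigReal (-n) (t + b) = √Real.pi * (trigReal n b * trigReal (-n) t +
    trigReal (-n) b * trigReal n t)
  simp only [trigReal, hn.not_gt, neg_lt_zero.2 hn, if_true, if_false, mul_add, Real.sin_add,
    Int.cast_neg, neg_mul, Real.sin_neg, Real.cos_neg]
  field_simp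

theorem trigFun_apply_neg {n : ℤ} (hn : 0 < n) (θ : Bdry) : trigFun n (-θ) = trigFun n θ := by
  induction θ using QuotientAddGroup.induction_on with | _ t
  change trigReal n (-t) = trigReal n t
  simp [trigReal, hn.not_gt]

theorem trigFun_neg_apply_neg {n : ℤ} (hn : 0 < n) (θ : Bdry) :
    trigFun (-n) (-θ) = -trigFun (-n) θ := by
  induction θ using QuotientAddGroup.induction_on with | _ t
  change trigReal (-n) (-t) = -trigReal (-n) t
  simp [trigReal, hn, neg_div]

/-- A function all of whose translates satisfy an addition formula with the functions `φ_n`,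
`φ_{-n}` of the shift is itself a combination of these two: by Fubini's theorem the formula holds
for some fixed base point and almost every shift. -/
theorem exists_eq_comb_of_translate {n : ℤ} (hn : 0 < n) {F F₁ F₂ : Bdry → ℝ}
    (hF : Measurable F) (hF₁ : Measurable F₁) (hF₂ : Measurable F₂)
    (h : ∀ a, ∀ᵐ θ : Bdry, F (θ + a) = trigFun n a * F₁ θ + trigFun (-n) a * F₂ θ) :
    ∃ α β : ℝ, ∀ᵐ θ : Bdry, F θ = α * trigFun n θ + β * trigFun (-n) θ := by
  have hm : ∀ k, Measurable (trigFun k) := fun k => (continuous_trigFun k).measurable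
  have hset : MeasurableSet {p : Bdry × Bdry |
      F (p.2 + p.1) = trigFun n p.1 * F₁ p.2 + trigFun (-n) p.1 * F₂ p.2} :=
    measurableSet_eq_fun (hF.comp (measurable_snd.add measurable_fst))
      ((((hm n).comp measurable_fst).mul (hF₁.comp measurable_snd)).add
        (((hm (-n)).comp measurable_fst).mul (hF₂.comp measurable_snd)))
  have h' : ∀ᵐ a : Bdry, ∀ᵐ θ : Bdry, F (θ + a) = trigFun n a * F₁ θ + trigFun (-n) a * F₂ θ :=
    .of_forall h
  rw [Measure.ae_ae_comm hset] at h'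
  obtain ⟨θ₀, hθ₀⟩ := h'.exists
  have hshift := (measurePreserving_add_right (volume : Measure Bdry)
    (-θ₀)).quasiMeasurePreserving.ae hθ₀
  refine ⟨√Real.pi * (trigFun n (-θ₀) * F₁ θ₀ + trigFun (-n) (-θ₀) * F₂ θ₀),
    √Real.pi * (trigFun n (-θ₀) * F₂ θ₀ - trigFun (-n) (-θ₀) * F₁ θ₀), ?_⟩
  filter_upwards [hshift] with θ hθ
  rw [add_comm θ₀, neg_add_cancel_right, trigFun_add hn, trigFun_neg_add hn] at hθ
  rw [hθ]
  ring

theorem coeFn_comb (a b : ℝ) (f g : L2Diamond) :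
    ((a • f + b • g : L2Diamond) : L2Bdry) =ᵐ[volume]
      fun θ => a * (f : L2Bdry) θ + b * (g : L2Bdry) θ := by
  filter_upwards [Lp.coeFn_add (a • (f : L2Bdry)) (b • (g : L2Bdry)),
    Lp.coeFn_smul a (f : L2Bdry), Lp.coeFn_smul b (g : L2Bdry)] with θ h1 h2 h3
  simp only [Submodule.coe_add, Submodule.coe_smul, h1, h2, h3, Pi.add_apply, Pi.smul_apply,
    smul_eq_mul]

section Eigenfunctions

variable {σ : ℂ → ℝ} (hσ : IsConductivity σ) (hrot : IsRotSymmetric σ)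

include hσ hrot

/-- If rotations act on `ψ` by an addition formula, they act on `R_σ ψ` by the same formula. -/
theorem NDMap_translate {ψ ψ₁ ψ₂ : L2Diamond} {a : Bdry} {c₁ c₂ : ℝ}
    (h : ∀ᵐ θ : Bdry, (ψ : L2Bdry) (θ + a) = c₁ * (ψ₁ : L2Bdry) θ + c₂ * (ψ₂ : L2Bdry) θ) :
    ∀ᵐ θ : Bdry, (NDMap σ ψ : L2Bdry) (θ + a) =
      c₁ * (NDMap σ ψ₁ : L2Bdry) θ + c₂ * (NDMap σ ψ₂ : L2Bdry) θ := by
  have h1 : ((c₁ • ψ₁ + c₂ • ψ₂ : L2Diamond) : L2Bdry) =ᵐ[volume]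
      fun θ => (ψ : L2Bdry) ((DiskSymmetry.rotation a).circle θ) := by
    filter_upwards [h, coeFn_comb c₁ c₂ ψ₁ ψ₂] with θ e1 e2
    rw [e2, ← e1]
    rfl
  have h2 := (DiskSymmetry.rotation a).NDMap_comp hσ hrot h1
  rw [NDMap_linear_comb hσ] at h2
  filter_upwards [h2, coeFn_comb c₁ c₂ (NDMap σ ψ₁) (NDMap σ ψ₂)] with θ e1 e2
  rw [← e2, e1]
  rfl

/-- If `ψ` is even (`ε = 1`) or odd (`ε = -1`), so is `R_σ ψ`. -/
theorem NDMap_reflect {ψ : L2Diamond} {ε : ℝ}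
    (h : ∀ᵐ θ : Bdry, (ψ : L2Bdry) (-θ) = ε * (ψ : L2Bdry) θ) :
    ∀ᵐ θ : Bdry, (NDMap σ ψ : L2Bdry) (-θ) = ε * (NDMap σ ψ : L2Bdry) θ := by
  have h1 : ((ε • ψ + (0 : ℝ) • ψ : L2Diamond) : L2Bdry) =ᵐ[volume]
      fun θ => (ψ : L2Bdry) (DiskSymmetry.reflection.circle θ) := by
    filter_upwards [h, coeFn_comb ε 0 ψ ψ] with θ e1 e2
    rw [e2, zero_mul, add_zero, ← e1]
    rfl
  have h2 := DiskSymmetry.reflection.NDMap_comp hσ hrot h1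
  rw [NDMap_linear_comb hσ] at h2
  filter_upwards [h2, coeFn_comb ε 0 (NDMap σ ψ) (NDMap σ ψ)] with θ e1 e2
  rw [zero_mul, add_zero] at e2
  rw [← e2, e1]
  rfl

/-- The addition formula for `ψ` carries over to `R_σ ψ`, which therefore lies in the span of `φ_n`
and `φ_{-n}`. -/
theorem exists_NDMap_eq_comb {n : ℤ} (hn : 0 < n) {ψ ψ₁ ψ₂ : L2Diamond} {c₁ c₂ : ℝ}
    (h : ∀ a, ∀ᵐ θ : Bdry, (ψ : L2Bdry) (θ + a) =
      (c₁ * trigFun n a) * (ψ₁ : L2Bdry) θ + (c₂ * trigFun (-n) a) * (ψ₂ : L2Bdry) θ) :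
    ∃ α β : ℝ, ∀ᵐ θ : Bdry, (NDMap σ ψ : L2Bdry) θ = α * trigFun n θ + β * trigFun (-n) θ := by
  have h1 := fun a => NDMap_translate hσ hrot (h a)
  generalize NDMap σ ψ = f at h1 ⊢
  generalize NDMap σ ψ₁ = f₁ at h1
  generalize NDMap σ ψ₂ = f₂ at h1
  have hmeas : ∀ g : L2Bdry, Measurable g := fun g => (Lp.stronglyMeasurable g).measurable
  refine exists_eq_comb_of_translate (F₁ := fun θ => c₁ * (f₁ : L2Bdry) θ)
    (F₂ := fun θ => c₂ * (f₂ : L2Bdry) θ) hn (hmeas _) ((hmeas _).const_mul c₁)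
    ((hmeas _).const_mul c₂) fun a => ?_
  filter_upwards [h1 a] with θ e
  rw [e]
  ring

/-- Rotations confine `R_σ φ_n` to the span of `φ_n` and `φ_{-n}`, and the reflection separates
the even from the odd function. -/
theorem exists_NDMap_trigDiamond {n : ℤ} (hn : n ≠ 0) :
    ∃ c : ℝ, NDMap σ (trigDiamond n hn) = c • trigDiamond n hn := by
  have htrans : ∀ (a : Bdry) {f g : Bdry → ℝ}, (∀ᵐ θ, f θ = g θ) →
      ∀ᵐ θ, f (θ + a) = g (θ + a) := by
    intro a f g hfg
    have h := (measurePreserving_add_right (volume : Measure Bdry) a).quasiMeasurePreserving.ae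
      (p := fun θ => f θ = g θ) hfg
    exact h
  have hneg : ∀ {f g : Bdry → ℝ}, (∀ᵐ θ, f θ = g θ) → ∀ᵐ θ, f (-θ) = g (-θ) := by
    intro f g hfg
    have h := (Measure.measurePreserving_neg (volume : Measure Bdry)).quasiMeasurePreserving.ae
      (p := fun θ => f θ = g θ) hfg
    exact h
  have hfinish : ∀ {ψ f : L2Diamond} {c : ℝ} {g : Bdry → ℝ}, (∀ᵐ θ, (ψ : L2Bdry) θ = g θ) →
      (∀ᵐ θ, (f : L2Bdry) θ = c * g θ) → f = c • ψ := by
    intro ψ f c g h1 h2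
    refine Subtype.ext (Lp.ext ?_)
    filter_upwards [h1, h2, Lp.coeFn_smul c (ψ : L2Bdry)] with θ e1 e2 e3
    rw [e2, ← e1, Submodule.coe_smul, e3, Pi.smul_apply, smul_eq_mul]
  have hφ : ∀ k, ∀ hk : k ≠ 0, ∀ᵐ θ, (trigDiamond k hk : L2Bdry) θ = trigFun k θ :=
    fun k hk => coeFn_trigDiamond hk
  rcases lt_or_gt_of_ne hn with h | hm
  · obtain ⟨m, rfl⟩ : ∃ m, n = -m := ⟨-n, (neg_neg n).symm⟩
    have hm : 0 < m := by omega
    obtain ⟨α, β, h⟩ := exists_NDMap_eq_comb hσ hrot hm (ψ := trigDiamond (-m) hn)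
      (ψ₁ := trigDiamond (-m) hn) (ψ₂ := trigDiamond m hm.ne') (c₁ := √Real.pi) (c₂ := √Real.pi)
      fun a => by
        filter_upwards [htrans a (hφ _ hn), hφ _ hm.ne', hφ _ hn] with θ e1 e2 e3
        rw [e1, e2, e3, trigFun_neg_add hm]
        ring
    have hrefl := NDMap_reflect hσ hrot (ψ := trigDiamond (-m) hn) (ε := -1) (by
      filter_upwards [hneg (hφ _ hn), hφ _ hn] with θ e1 e2
      rw [e1, e2, trigFun_neg_apply_neg hm, neg_one_mul])
    refine ⟨β, hfinish (hφ _ hn) ?_⟩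
    filter_upwards [h, hneg h, hrefl] with θ e1 e2 e3
    rw [trigFun_apply_neg hm, trigFun_neg_apply_neg hm, e3] at e2
    linarith
  · have hm' : -n ≠ 0 := by omega
    obtain ⟨α, β, h⟩ := exists_NDMap_eq_comb hσ hrot hm (ψ := trigDiamond n hn)
      (ψ₁ := trigDiamond n hn) (ψ₂ := trigDiamond (-n) hm') (c₁ := √Real.pi) (c₂ := -√Real.pi)
      fun a => by
        filter_upwards [htrans a (hφ _ hn), hφ _ hm', hφ _ hn] with θ e1 e2 e3
        rw [e1, e2, e3, trigFun_add hm]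
        ring
    have hrefl := NDMap_reflect hσ hrot (ψ := trigDiamond n hn) (ε := 1) (by
      filter_upwards [hneg (hφ _ hn), hφ _ hn] with θ e1 e2
      rw [e1, e2, trigFun_apply_neg hm, one_mul])
    refine ⟨α, hfinish (hφ _ hn) ?_⟩
    filter_upwards [h, hneg h, hrefl] with θ e1 e2 e3
    rw [trigFun_apply_neg hm, trigFun_neg_apply_neg hm, e3] at e2
    linarith

end Eigenfunctions

/-! ### The linear system -/

theorem isConductivity_one : IsConductivity (fun _ => 1) :=
  ⟨memLp_top_const 1, 1, one_pos, .of_forall fun _ => le_rfl⟩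

theorem isRotSymmetric_one : IsRotSymmetric (fun _ => 1) := ⟨fun _ => 1, .of_forall fun _ => rfl⟩

theorem inner_NDDiff_comm {σ : ℂ → ℝ} (hσ : IsConductivity σ) (ψ φ : L2Diamond) :
    inner ℝ (NDDiff σ ψ : L2Bdry) (φ : L2Bdry) = inner ℝ (ψ : L2Bdry) (NDDiff σ φ : L2Bdry) := by
  simp only [NDDiff, Submodule.coe_sub, inner_sub_left, inner_sub_right, inner_NDMap_comm hσ,
    inner_NDMap_comm isConductivity_one]

theorem exists_NDDiff_trigBasis {N : ℕ} {σ : ℂ → ℝ} (hσ : IsConductivity σ)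
    (hrot : IsRotSymmetric σ) (n : Idx N) :
    ∃ c : ℝ, NDDiff σ (trigBasis n) = c • trigBasis n := by
  have hn : (n : ℤ) ≠ 0 := Finset.ne_of_mem_erase n.2
  obtain ⟨a, ha⟩ := exists_NDMap_trigDiamond hσ hrot hn
  obtain ⟨b, hb⟩ := exists_NDMap_trigDiamond isConductivity_one isRotSymmetric_one hn
  refine ⟨a - b, ?_⟩
  rw [sub_smul]
  exact congrArg₂ (· - ·) ha hb

theorem integral_cos_int_mul (k : ℤ) :
    ∫ t in (-Real.pi)..Real.pi, Real.cos (k * t) = if k = 0 then 2 * Real.pi else 0 := by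
  split_ifs with hk
  · simp [hk]
    ring
  · have hk' : (k : ℝ) ≠ 0 := by exact_mod_cast hk
    rw [intervalIntegral.integral_comp_mul_left (fun x => Real.cos x) hk', integral_cos]
    simp

theorem integral_sin_int_mul (k : ℤ) : ∫ t in (-Real.pi)..Real.pi, Real.sin (k * t) = 0 := by
  by_cases hk : k = 0
  · simp [hk]
  · have hk' : (k : ℝ) ≠ 0 := by exact_mod_cast hk
    rw [intervalIntegral.integral_comp_mul_left (fun x => Real.sin x) hk', integral_sin]
    simp

theorem integral_trigReal_mul {n m : ℤ} (hn : n ≠ 0) (hm : m ≠ 0) :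
    ∫ t in (-Real.pi)..Real.pi, trigReal n t * trigReal m t = if n = m then 1 else 0 := by
  have hπ := Real.pi_pos
  have hs : √Real.pi * √Real.pi = Real.pi := Real.mul_self_sqrt hπ.le
  have hc : ∀ k : ℤ, IntervalIntegrable (fun t : ℝ => Real.cos (k * t)) volume (-Real.pi) Real.pi :=
    fun k => (by fun_prop : Continuous fun t : ℝ => Real.cos (k * t)).intervalIntegrable _ _
  have hS : ∀ k : ℤ, IntervalIntegrable (fun t : ℝ => Real.sin (k * t)) volume (-Real.pi) Real.pi :=
    fun k => (by fun_prop : Continuous fun t : ℝ => Real.sin (k * t)).intervalIntegrable _ _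
  have hadd : ∀ t : ℝ, ((n + m : ℤ) : ℝ) * t = n * t + m * t := fun t => by push_cast; ring
  have hsub : ∀ t : ℝ, ((n - m : ℤ) : ℝ) * t = n * t - m * t := fun t => by push_cast; ring
  rcases lt_or_gt_of_ne hn with h1 | h1 <;> rcases lt_or_gt_of_ne hm with h2 | h2
  · have e : ∀ t, trigReal n t * trigReal m t = (2 * Real.pi)⁻¹ *
        (Real.cos ((n - m : ℤ) * t) - Real.cos ((n + m : ℤ) * t)) := fun t => by
      simp only [trigReal, h1, h2, if_true]
      rw [div_mul_div_comm, hs, hadd, hsub, Real.cos_add, Real.cos_sub]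
      field_simp
      ring
    simp only [e]
    rw [intervalIntegral.integral_const_mul, intervalIntegral.integral_sub (hc _) (hc _),
      integral_cos_int_mul, integral_cos_int_mul, if_neg (by omega : n + m ≠ 0)]
    simp only [sub_eq_zero, sub_zero]
    split_ifs
    · field_simp
    · simp
  · have e : ∀ t, trigReal n t * trigReal m t = (2 * Real.pi)⁻¹ *
        (Real.sin ((n - m : ℤ) * t) + Real.sin ((n + m : ℤ) * t)) := fun t => by
      simp only [trigReal, h1, h2.not_gt, if_true, if_false]
      rw [div_mul_div_comm, hs, hadd, hsub, Real.sin_add, Real.sin_sub]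
      field_simp
      ring
    simp only [e]
    rw [intervalIntegral.integral_const_mul, intervalIntegral.integral_add (hS _) (hS _),
      integral_sin_int_mul, integral_sin_int_mul, if_neg (by omega)]
    simp
  · have e : ∀ t, trigReal n t * trigReal m t = (2 * Real.pi)⁻¹ *
        (Real.sin ((n + m : ℤ) * t) - Real.sin ((n - m : ℤ) * t)) := fun t => by
      simp only [trigReal, h1.not_gt, h2, if_true, if_false]
      rw [div_mul_div_comm, hs, hadd, hsub, Real.sin_add, Real.sin_sub]
      field_simp
      ring
    simp only [e]
    rw [intervalIntegral.integral_const_mul, intervalIntegral.integral_sub (hS _) (hS _),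
      integral_sin_int_mul, integral_sin_int_mul, if_neg (by omega)]
    simp
  · have e : ∀ t, trigReal n t * trigReal m t = (2 * Real.pi)⁻¹ *
        (Real.cos ((n - m : ℤ) * t) + Real.cos ((n + m : ℤ) * t)) := fun t => by
      simp only [trigReal, h1.not_gt, h2.not_gt, if_false]
      rw [div_mul_div_comm, hs, hadd, hsub, Real.cos_add, Real.cos_sub]
      field_simp
      ring
    simp only [e]
    rw [intervalIntegral.integral_const_mul, intervalIntegral.integral_add (hc _) (hc _),
      integral_cos_int_mul, integral_cos_int_mul, if_neg (by omega : n + m ≠ 0)]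
    simp only [sub_eq_zero, add_zero]
    split_ifs
    · field_simp
    · simp

theorem inner_trigBasis {N : ℕ} (n j : Idx N) :
    inner ℝ (trigBasis n : L2Bdry) (trigBasis j : L2Bdry) = if n = j then 1 else 0 := by
  have h : inner ℝ (trigBasis n : L2Bdry) (trigBasis j : L2Bdry) =
      ∫ θ, trigFun n θ * trigFun j θ := by
    rw [L2.inner_def]
    refine integral_congr_ae ?_
    filter_upwards [coeFn_trigDiamond (Finset.ne_of_mem_erase n.2),
      coeFn_trigDiamond (Finset.ne_of_mem_erase j.2)] with θ h1 h2
    rw [inner_real_eq_mul]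
    exact congrArg₂ (· * ·) h1 h2
  rw [h, integral_bdry_eq]
  simp only [trigFun_coe, Subtype.ext_iff]
  exact integral_trigReal_mul (Finset.ne_of_mem_erase n.2) (Finset.ne_of_mem_erase j.2)

/-- The vector of the full-boundary matrix solves the linear system exactly, since both sides
reduce to the eigenvalue of `φ_j` times `(ψ_n, φ_j)`. -/
theorem Psi_mulVec_vecRows {M N : ℕ} (el : Electrodes M) {σ : ℂ → ℝ} (hσ : IsConductivity σ)
    (hrot : IsRotSymmetric σ) : (Psi N el).mulVec (vecRows (ndMatrix N σ)) = gVec N el σ := by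
  ext ⟨n, j⟩
  obtain ⟨c, hc⟩ := exists_NDDiff_trigBasis hσ hrot j
  have hR : ∀ k, ndMatrix N σ j k = if j = k then c else 0 := fun k => by
    change inner ℝ (NDDiff σ (trigBasis j) : L2Bdry) (trigBasis k : L2Bdry) = _
    rw [hc, Submodule.coe_smul, real_inner_smul_left, inner_trigBasis, mul_ite, mul_one, mul_zero]
  have hg : gVec N el σ (n, j) = c * coeff (current el n) j := by
    change inner ℝ (NDDiff σ (current el n) : L2Bdry) (trigBasis j : L2Bdry) = _
    rw [inner_NDDiff_comm hσ, hc, Submodule.coe_smul, real_inner_smul_right]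
    rfl
  rw [hg]
  simp only [Matrix.mulVec, dotProduct, Psi, PsiBlock, vecRows, Matrix.of_apply,
    Fintype.sum_prod_type]
  rw [Finset.sum_eq_single j (fun i _ hi => by simp [hi]) (fun h => absurd (Finset.mem_univ _) h),
    Finset.sum_eq_single j (fun k _ hk => by simp [hR, hk.symm])
      (fun h => absurd (Finset.mem_univ _) h)]
  simp [hR, mul_comm]

theorem card_idx {N : ℕ} (hN : Even N) : Fintype.card (Idx N) = N := by
  obtain ⟨k, rfl⟩ := hN
  have h : ((k + k : ℕ) : ℤ) / 2 = k := by omega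
  rw [Fintype.card_coe, Finset.card_erase_of_mem (by simp; omega), Int.card_Icc, h]
  omega

theorem isUnit_of_rank_eq_card {ι : Type*} [Fintype ι] [DecidableEq ι]
    {A : Matrix ι ι ℝ} (hA : A.rank = Fintype.card ι) : IsUnit A := by
  rw [← Matrix.linearIndependent_cols_iff_isUnit, linearIndependent_iff_card_eq_finrank_span,
    ← hA, Matrix.rank_eq_finrank_span_cols]
  rfl

end EIT

theorem lemma3p1 {M N : ℕ} (hNeven : Even N) (hNM : N < M) (el : Electrodes M)
    (σ : ℂ → ℝ) (hσ : IsConductivity σ) (hrot : IsRotSymmetric σ) (hone : IsOneNearBoundary σ)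
    (hfull : (Psi N el).rank = N ^ 2) :
    (NDWellDefined σ ∧ NDWellDefined (fun _ => 1)) ∧
    (∃! r : Idx N × Idx N → ℝ,
      ((Psi N el).transpose * Psi N el).mulVec r = (Psi N el).transpose.mulVec (gVec N el σ)) ∧
    ((Psi N el).transpose * Psi N el).mulVec (vecRows (ndMatrix N σ)) =
      (Psi N el).transpose.mulVec (gVec N el σ) := by
  have hsol : ((Psi N el).transpose * Psi N el).mulVec (vecRows (ndMatrix N σ)) =
      (Psi N el).transpose.mulVec (gVec N el σ) := by
    rw [← Matrix.mulVec_mulVec, Psi_mulVec_vecRows el hσ hrot]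
  have hunit : IsUnit ((Psi N el).transpose * Psi N el) := by
    refine isUnit_of_rank_eq_card ?_
    rw [Matrix.rank_transpose_mul_self, hfull, Fintype.card_prod, card_idx hNeven, sq]
  exact ⟨⟨ndWellDefined hσ, ndWellDefined isConductivity_one⟩,
    ⟨_, hsol, fun r hr => Matrix.mulVec_injective_of_isUnit hunit (hr.trans hsol.symm)⟩, hsol⟩
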